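/- Let $C$ be a cycle whose $m$ nodes are goods (the degenerate cases $m\le 2$, a path on at most two nodes, are included). A utility function assigns a non-negative real number to every good and is extended additively to sets of goods. A bundle is a (possibly empty) set of goods that induces a connected subgraph of $C$. An $n$-split of $C$ is a sequence $P_1,\dots,P_n$ of pairwise disjoint bundles whose union is the set of all goods; an allocation to agents $1,\dots,n$ is an $n$-split in which $P_i$ is given to agent $i$. The maximin share of an agent with utility function $u$ is $$\mathit{mms}^{(n)}(C,u)=\max\{q\ge 0:\text{ there is an } n\text{-split } P_1,\dots,P_n \text{ of } C \text{ with } u(P_i)\ge q \text{ for all } i\}.$$ For $c>0$, an allocation $P_1,\dots,P_n$ to agents with utility functions $u_1,\dots,u_n$ is $c$-sufficient if $u_i(P_i)\ge c\cdot \mathit{mms}^{(n)}(C,u_i)$ for every $i$. Two agents are of the same type if they have the same utility function. **Theorem.** (a) For every cycle $C$ of goods, every $n\ge 1$ and every collection of $n$ agents of at most three types, a $\frac34$-sufficient allocation of the goods on $C$ to the $n$ agents exists. (b) The constant $\frac34$ cannot be improved: there are a cycle $C$ with at least three nodes and a collection of agents of exactly three types such that, for every $c>\frac34$, no $c$-sufficient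 allocation of the goods on $C$ to these agents exists. -/

import Mathlib

/-- The value of a set `P` of goods under the additive extension of a utility function `u`. -/
def bundleValue {V : Type*} (u : V → ℝ) (P : Finset V) : ℝ := ∑ v ∈ P, u v

/-- A `G`-bundle: a set of goods that induces a connected subgraph of `G`; the empty set
is allowed. -/
def IsBundle {V : Type*} (G : SimpleGraph V) (P : Finset V) : Prop :=
  (G.induce (P : Set V)).Preconnected

/-- A `(G, n)`-split: a sequence of `n` pairwise disjoint (possibly empty) `G`-bundles that
together contain all goods. A `(G, n)`-allocation is a `(G, n)`-split whose `i`-th bundle is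
the one assigned to agent `i`. -/
structure IsSplit {V : Type*} (G : SimpleGraph V) {n : ℕ} (P : Fin n → Finset V) : Prop where
  bundle : ∀ i, IsBundle G (P i)
  disjoint : ∀ i j, i ≠ j → Disjoint (P i) (P j)
  cover : ∀ v, ∃ i, v ∈ P i

/-- The nonnegative reals `q` for which there is a `q`-strong `n`-split of `G` under `u`, that
is, an `n`-split in which every bundle has value at least `q`. -/
def strongSplitValues {V : Type*} (G : SimpleGraph V) (n : ℕ) (u : V → ℝ) : Set ℝ :=
  {q | 0 ≤ q ∧ ∃ P : Fin n → Finset V, IsSplit G P ∧ ∀ i, q ≤ bundleValue u (P i)}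

/-- The maximin share `mms⁽ⁿ⁾(G, u)`: the largest `q` for which there is a `q`-strong `n`-split
of `G`. By `isGreatest_maximinShare` below, this supremum is a maximum. -/
noncomputable def maximinShare {V : Type*} (G : SimpleGraph V) (n : ℕ) (u : V → ℝ) : ℝ :=
  sSup (strongSplitValues G n u)

/-- An allocation `P` of the goods on `G` to `n` agents with utility functions `u 0, u 1, …` is
`c`-sufficient if every agent `i` values her bundle at `c` times her maximin share or more. -/
def IsSufficientAllocation {V : Type*} (G : SimpleGraph V) {n : ℕ} (u : Fin n → V → ℝ) (c : ℝ)
    (P : Fin n → Finset V) : Prop :=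
  IsSplit G P ∧ ∀ i, c * maximinShare G n (u i) ≤ bundleValue (u i) (P i)

/-- The number of types of a collection of agents: two agents are of the same type if they have
the same utility function. -/
noncomputable def numTypes {V : Type*} {n : ℕ} (u : Fin n → V → ℝ) : ℕ := (Set.range u).ncard

theorem isGreatest_maximinShare {V : Type*} [Finite V] {G : SimpleGraph V}
    (hG : G.Preconnected) {n : ℕ} (hn : 1 ≤ n) {u : V → ℝ} (hu : ∀ v, 0 ≤ u v) :
    IsGreatest (strongSplitValues G n u) (maximinShare G n u) := by
  classical
  have := Fintype.ofFinite V
  have : Nonempty (Fin n) := ⟨⟨0, hn⟩⟩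
  have hval : ∀ P : Finset V, 0 ≤ bundleValue u P := fun P => Finset.sum_nonneg fun v _ => hu v
  have hne : (strongSplitValues G n u).Nonempty := by
    refine ⟨0, le_rfl, fun i => if i = ⟨0, hn⟩ then Finset.univ else ∅, ⟨?_, ?_, ?_⟩,
      fun i => hval _⟩
    · intro i
      by_cases hi : i = ⟨0, hn⟩
      · have h : ((Finset.univ : Finset V) : Set V) = Set.univ := Finset.coe_univ
        have h2 : IsBundle G Finset.univ := by
          unfold IsBundle
          rw [h]
          exact (SimpleGraph.induceUnivIso G).preconnected_iff.mpr hG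
        simpa [hi] using h2
      · have h2 : IsBundle G ∅ := fun x => absurd x.2 (by simp)
        simpa [hi] using h2
    · intro i j hij
      by_cases hi : i = ⟨0, hn⟩
      · have hj : j ≠ ⟨0, hn⟩ := fun h => hij (hi.trans h.symm)
        simp [hj]
      · simp [hi]
    · exact fun v => ⟨⟨0, hn⟩, by simp⟩
  have heq : strongSplitValues G n u =
      ⋃ P ∈ {P : Fin n → Finset V | IsSplit G P},
        Set.Icc 0 (⨅ i, bundleValue u (P i)) := by
    ext q
    simp only [strongSplitValues, Set.mem_ofPred_eq, Set.mem_iUnion, Set.mem_Icc, exists_prop]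
    have key : ∀ P : Fin n → Finset V, (∀ i, q ≤ bundleValue u (P i)) ↔
        q ≤ ⨅ i, bundleValue u (P i) :=
      fun P => (le_ciInf_iff (Set.finite_range _).bddBelow).symm
    constructor
    · rintro ⟨h0, P, hP, h⟩
      exact ⟨P, hP, h0, (key P).1 h⟩
    · rintro ⟨P, hP, h0, h⟩
      exact ⟨h0, P, hP, (key P).2 h⟩
  have hc : IsCompact (strongSplitValues G n u) := by
    rw [heq]
    exact (Set.toFinite _).isCompact_biUnion fun P _ => isCompact_Icc
  exact hc.isGreatest_sSup hne

/-!
Three fourths of the maximin share can be guaranteed to agents of three types on a cycle.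

**Reduction.** The cycle is unrolled to the integers. A type with positive maximin share, measured
in units of that share, is turned into a `Cutting`: a monotone function `U` on `ℤ`, whose
increments are the values of stretches of goods, together with the positions at which an optimal
split cuts the cycle, so that each of its `n` pieces per turn is worth at least `1`
(`exists_cutting`). It then has to be shown that every multiset of `n` agents with at most three
different cuttings `x`, `y`, `z` is `Solvable`: the cycle can be cut open at some position and
divided from left to right so that every agent gets a stretch worth at least `3 / 4`
(`solvable_three`). A type with maximin share `0` may borrow the cutting of another type.

**Moving knife.** On a path, agents who can each cut what is left into as many acceptable pieces
as there are agents can all be served: the agent whose first piece ends first takes it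
(`Serv.of_forall`). So everybody is served if some position is *good* for all types, that is,
opening the cycle there still leaves every type `n` pieces worth `3 / 4`; or if some stretch lies
within a piece of each type and is worth `3 / 4` to one of them, as it can be given away with `n -
1` whole pieces left to everybody. The negation of both is `Stuck`.

**A type that is one piece short.** Consider a stretch on which `x` and `y` have as many pieces as
there are agents, and `z` one less, with a fragment at the left end (`Slots`). Divide it from left
to right; at each step the type whose piece ends first determines the next piece. If `z` finds
this piece acceptable, it is given to `z`. Otherwise it is given to its owner, and the fragment
left to `z` from her current piece grows by more than `1 / 4`; as soon as it reaches `3 / 4`, type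
`z` is no longer short and the moving knife finishes (`Slots.State.step`). Hence `z` accepts one
of three consecutive pieces, and one of two if cuts of `x` and `y` are never good for `z`. The
three resulting ways to divide a stretch (`Slots.State.serv_of_two_mul_le`,
`Slots.State.serv_of_le_add`, `Slots.State.serv_of_le`) differ in what they assume about the cuts
and in the number of agents of type `z` that they can serve. Each yields an `Engine`; an engine
can be started at a position that is good for `x` and `y`, since `z` has half a piece on one of
its sides and the situation can be reflected, or after giving away a suitable stretch within a
piece of `x` and a piece of `y`.

**Conclusion.** Let `x`, `y`, `z` be sorted by decreasing number of agents. The first engine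
applies unless the cuts of `x` and `y` *alternate*: no position is good for both, and no piece of
one lies within a piece of the other (`Alternate`). Using this, the other engines apply unless the
cuts of all three types alternate (`solvable_three_of_alternate`), or at least half of the agents
are of type `x`. In the latter case everybody can get a piece of `x`, because each other type
accepts one of any two consecutive pieces of `x` (`Alternate.accepts_or_accepts`). In the former
case, unless an engine applies once more, everybody accepts every piece of `x`
(`accepts_of_alternate`).

**Optimality.** The example has `18` goods, all worth at most `3`, and nine agents whose maximin
shares are at least `4`. An agent who gets more than `3 / 4` of her share needs at least two
goods, so every bundle is a pair of neighbours, and there are only two ways to pair up the cycle.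
Either way there are four agents of one type but only three pairs worth more than `3` to them.
-/

/-! ### Cuttings and served stretches of the unrolled cycle -/

/-- A utility function on a cycle of `m` goods together with an `n`-split all of whose bundles
are worth at least `1`, both unrolled to the integers. Good number `p` lies between the positions
`p` and `p + 1`; the goods between the positions `p ≤ q` are worth `U q - U p`; the split cuts
the cycle at the positions `cut k`. -/
structure Cutting (m n : ℕ) where
  U : ℤ → ℝ
  mono : Monotone U
  period : ∀ p q, U (q + m) - U (p + m) = U q - U p
  cut : ℤ → ℤ
  cut_period : ∀ k, cut (k + n) = cut k + m
  one_le : ∀ k, 1 ≤ U (cut (k + 1)) - U (cut k)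

namespace Cutting

variable {m n : ℕ}

theorem strictMono_cut (S : Cutting m n) : StrictMono S.cut := by
  refine strictMono_int_of_lt_succ fun k => ?_
  by_contra! h
  have := S.mono h
  have := S.one_le k
  linarith

theorem exists_cut_le_lt (S : Cutting m n) (p : ℤ) :
    ∃ k, S.cut k ≤ p ∧ p < S.cut (k + 1) := by
  have hs := S.strictMono_cut
  have hup : ∀ j : ℕ, ∀ k, S.cut k + j ≤ S.cut (k + j) := by
    intro j
    induction j with
    | zero => intro k; simp
    | succ j ih =>
      intro k
      have h1 := ih k
      have h2 : S.cut (k + j) < S.cut (k + (j + 1 : ℕ)) := hs (by push_cast; omega)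
      push_cast at *
      omega
  obtain ⟨k, hk, hmax⟩ := Int.exists_greatest_of_bdd (P := fun k => S.cut k ≤ p)
    ⟨(p - S.cut 0).toNat, fun z hz => by
      by_contra! hlt
      have h := hup z.toNat 0
      have : (z.toNat : ℤ) = z := Int.toNat_of_nonneg (by omega)
      rw [this, zero_add] at h
      have := Int.self_le_toNat (p - S.cut 0)
      omega⟩
    ⟨-(S.cut 0 - p).toNat, by
      have h := hup (S.cut 0 - p).toNat (-(S.cut 0 - p).toNat)
      have := Int.self_le_toNat (S.cut 0 - p)
      rw [neg_add_cancel] at h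
      omega⟩
  refine ⟨k, hk, ?_⟩
  by_contra! h
  have := hmax _ h
  omega

/-- The mirror image of a cutting. -/
def reflect (S : Cutting m n) : Cutting m n where
  U p := -S.U (-p)
  mono p q h := neg_le_neg (S.mono (neg_le_neg h))
  period p q := by
    have := S.period (-q - m) (-p - m)
    simp only [sub_add_cancel] at this
    rw [neg_add', neg_add']
    linarith
  cut k := -S.cut (-k)
  cut_period k := by
    have := S.cut_period (-k - n)
    rw [sub_add_cancel] at this
    rw [neg_add']
    omega
  one_le k := by
    have := S.one_le (-k - 1)
    rw [sub_add_cancel] at this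
    rw [neg_add', neg_neg, neg_neg]
    linarith

@[simp] theorem reflect_U (S : Cutting m n) (p : ℤ) : S.reflect.U p = -S.U (-p) := rfl

@[simp] theorem reflect_cut (S : Cutting m n) (k : ℤ) : S.reflect.cut k = -S.cut (-k) := rfl

@[simp] theorem reflect_reflect (S : Cutting m n) : S.reflect.reflect = S := by
  cases S
  simp [reflect]

end Cutting

/-- `Serv p q M`: the goods between the positions `p` and `q` can be divided, from left to right,
among the agents `M` so that each of them gets a stretch worth at least `3 / 4`. Goods may be
left over at the right end. -/
inductive Serv {m n : ℕ} : ℤ → ℤ → Multiset (Cutting m n) → Prop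
  | nil {p q : ℤ} (h : p ≤ q) : Serv p q 0
  | cons {p p' q : ℤ} {S : Cutting m n} {M : Multiset (Cutting m n)} (h : p ≤ p')
      (hS : 3 / 4 ≤ S.U p' - S.U p) (hM : Serv p' q M) : Serv p q (S ::ₘ M)

namespace Serv

variable {m n : ℕ} {p q : ℤ} {M : Multiset (Cutting m n)}

theorem le (h : Serv p q M) : p ≤ q := by
  induction h with
  | nil h => exact h
  | cons h _ _ ih => exact h.trans ih

theorem mono_left (h : Serv p q M) {p₀ : ℤ} (hp : p₀ ≤ p) : Serv p₀ q M := by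
  cases h with
  | nil h => exact .nil (hp.trans h)
  | @cons _ p' _ S _ h hS hM =>
    have := S.mono hp
    exact .cons (hp.trans h) (by linarith) hM

theorem append {r : ℤ} {M' : Multiset (Cutting m n)} (h : Serv p q M) (h' : Serv q r M') :
    Serv p r (M + M') := by
  induction h with
  | nil h => simpa using h'.mono_left h
  | cons h hS _ ih =>
    rw [Multiset.cons_add]
    exact .cons h hS (ih h')

theorem reflect (h : Serv p q M) : Serv (-q) (-p) (M.map Cutting.reflect) := by
  induction h with
  | nil h => simpa using Serv.nil (neg_le_neg h)
  | @cons p p' q S M h hS _ ih =>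
    rw [Multiset.map_cons, ← Multiset.singleton_add, add_comm]
    refine ih.append ?_
    rw [← Multiset.cons_zero]
    exact .cons (neg_le_neg h) (by simp only [Cutting.reflect_U, neg_neg]; linarith) (.nil le_rfl)

theorem exists_first {S : Cutting m n} {r : ℕ} (h : Serv p q (Multiset.replicate (r + 1) S)) :
    ∃ p', p ≤ p' ∧ 3 / 4 ≤ S.U p' - S.U p ∧ Serv p' q (Multiset.replicate r S) := by
  generalize hN : Multiset.replicate (r + 1) S = N at h
  cases h with
  | nil h => simp at hN
  | @cons _ p' _ S' M' h hS hM =>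
    have h1 : S' = S := Multiset.eq_of_mem_replicate (n := r + 1) (by rw [hN]; simp)
    subst h1
    rw [Multiset.replicate_succ, Multiset.cons_inj_right] at hN
    exact ⟨p', h, hS, hN ▸ hM⟩

/-- The moving-knife argument on a path: if every agent can cut the stretch into as many pieces
worth `3 / 4` to her as there are agents, then everybody can be served. The agent whose first
piece ends first takes it. -/
theorem of_forall (hpq : p ≤ q)
    (h : ∀ S ∈ M, Serv p q (Multiset.replicate (Multiset.card M) S)) : Serv p q M := by
  induction hr : Multiset.card M generalizing p M with
  | zero => rw [Multiset.card_eq_zero.1 hr]; exact .nil hpq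
  | succ r ih =>
    rw [hr] at h
    have hex : ∀ S : Cutting m n, ∃ p', S ∈ M → p ≤ p' ∧ 3 / 4 ≤ S.U p' - S.U p ∧
        Serv p' q (Multiset.replicate r S) := by
      intro S
      by_cases hS : S ∈ M
      · obtain ⟨p', hp'⟩ := (h S hS).exists_first
        exact ⟨p', fun _ => hp'⟩
      · exact ⟨0, fun h => absurd h hS⟩
    choose f hf using hex
    have hne : M ≠ 0 := by rintro rfl; simp at hr
    classical
    obtain ⟨S, hS, hmin⟩ := Finset.exists_min_image M.toFinset f
      (by rwa [Multiset.toFinset_nonempty])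
    rw [Multiset.mem_toFinset] at hS
    obtain ⟨h1, h2, h3⟩ := hf S hS
    obtain ⟨M', rfl⟩ := Multiset.exists_cons_of_mem hS
    refine .cons h1 h2 (ih h3.le ?_ (by simpa using hr))
    intro S' hS'
    have hmem : S' ∈ S ::ₘ M' := Multiset.mem_cons_of_mem hS'
    have hc : Multiset.card M' = r := by simpa using hr
    rw [hc]
    exact (hf S' hmem).2.2.mono_left (hmin S' (by simpa using hmem))

theorem of_seq {S : Cutting m n} {X : ℕ → ℤ} {i r : ℕ} (hp : p ≤ X i) (hq : X (i + r) ≤ q)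
    (h : ∀ j, i ≤ j → j < i + r → X j ≤ X (j + 1) ∧ 3 / 4 ≤ S.U (X (j + 1)) - S.U (X j)) :
    Serv p q (Multiset.replicate r S) := by
  induction r generalizing i p with
  | zero => exact .nil (hp.trans hq)
  | succ r ih =>
    rw [Multiset.replicate_succ]
    obtain ⟨h1, h2⟩ := h i le_rfl (by omega)
    refine mono_left ?_ hp
    refine .cons h1 h2 (ih le_rfl (by rwa [add_assoc, add_comm 1]) fun j hj hj' =>
      h j (by omega) (by omega))

end Serv

/-- The agents `M` can be served on the whole cycle, cut open at some position. -/
def Solvable {m n : ℕ} (M : Multiset (Cutting m n)) : Prop := ∃ p, Serv p (p + m) M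

theorem Solvable.of_reflect {m n : ℕ} {M : Multiset (Cutting m n)}
    (h : Solvable (M.map Cutting.reflect)) : Solvable M := by
  obtain ⟨p, hp⟩ := h
  refine ⟨-(p + m), ?_⟩
  have := hp.reflect
  rw [Multiset.map_map] at this
  simp only [Function.comp_def, Cutting.reflect_reflect, Multiset.map_id'] at this
  convert this using 1
  ring

/-! ### Serving a stretch on which one type is a piece short -/

/-- A stretch ending at `q` on which the types `x` and `y` have `N` disjoint pieces
(`[X j, X (j + 1)]` and `[Y j, Y (j + 1)]`) while the type `z` has only `N - 1` pieces
`[Z j, Z (j + 1)]`. -/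
structure Slots {m n : ℕ} (x y z : Cutting m n) (N : ℕ) (q : ℤ) where
  X : ℕ → ℤ
  Y : ℕ → ℤ
  Z : ℕ → ℤ
  hX : ∀ j < N, X j ≤ X (j + 1) ∧ 3 / 4 ≤ x.U (X (j + 1)) - x.U (X j)
  hY : ∀ j < N, Y j ≤ Y (j + 1) ∧ 3 / 4 ≤ y.U (Y (j + 1)) - y.U (Y j)
  hZ : ∀ j, j + 1 < N → Z j ≤ Z (j + 1) ∧ 1 ≤ z.U (Z (j + 1)) - z.U (Z j)
  hXq : X N ≤ q
  hYq : Y N ≤ q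
  hZq : Z (N - 1) ≤ q

namespace Slots

variable {m n N : ℕ} {x y z : Cutting m n} {q : ℤ}

/-- The same stretch with the roles of `x` and `y` exchanged. -/
def swap (F : Slots x y z N q) : Slots y x z N q :=
  ⟨F.Y, F.X, F.Z, F.hY, F.hX, F.hZ, F.hYq, F.hXq, F.hZq⟩

/-- After `t` agents have been served up to the position `e`, there remain `mx`, `my`, `mz` agents
of the types `x`, `y`, `z`, and the pieces from number `t` on are untouched for every type that
still has agents to be served. -/
structure State (F : Slots x y z N q) (t : ℕ) (e : ℤ) (mx my mz : ℕ) : Prop where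
  sum : t + mx + my + mz = N
  X : 0 < mx → e ≤ F.X t
  Y : 0 < my → e ≤ F.Y t
  Z : 0 < mz → e ≤ F.Z t
  le : e ≤ q

/-- What type `z` still gets from the piece that has been cut into at position `e`. -/
def rest (F : Slots x y z N q) (t : ℕ) (e : ℤ) : ℝ := z.U (F.Z t) - z.U e

variable {F : Slots x y z N q} {t mx my mz : ℕ} {e : ℤ}

theorem State.swap (h : F.State t e mx my mz) : F.swap.State t e my mx mz :=
  ⟨by have := h.sum; omega, h.Y, h.X, h.Z, h.le⟩

/-- The agents of the three types. -/
abbrev agents (x y z : Cutting m n) (mx my mz : ℕ) : Multiset (Cutting m n) :=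
  Multiset.replicate mx x + Multiset.replicate my y + Multiset.replicate mz z

theorem agents_swap (x y z : Cutting m n) (mx my mz : ℕ) :
    agents x y z mx my mz = agents y x z my mx mz := by
  simp only [agents, add_comm (Multiset.replicate mx x)]

theorem agents_succ_left (x y z : Cutting m n) (mx my mz : ℕ) :
    agents x y z (mx + 1) my mz = x ::ₘ agents x y z mx my mz := by
  simp [agents, Multiset.replicate_succ]

theorem agents_succ_right (x y z : Cutting m n) (mx my mz : ℕ) :
    agents x y z mx my (mz + 1) = z ::ₘ agents x y z mx my mz := by
  simp [agents, Multiset.replicate_succ]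

theorem mem_agents {S : Cutting m n} (h : S ∈ agents x y z mx my mz) :
    (S = x ∧ 0 < mx) ∨ (S = y ∧ 0 < my) ∨ (S = z ∧ 0 < mz) := by
  simp only [agents, Multiset.mem_add, Multiset.mem_replicate, ← Nat.pos_iff_ne_zero] at h
  tauto

theorem card_agents (x y z : Cutting m n) (mx my mz : ℕ) :
    Multiset.card (agents x y z mx my mz) = mx + my + mz := by
  simp [agents]

/-- The types `x` and `y` have enough pieces left, so the moving knife applies as soon as type `z`
has, too. -/
theorem State.serv_of_forall (h : F.State t e mx my mz)
    (hz : 0 < mz → Serv e q (Multiset.replicate (mx + my + mz) z)) :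
    Serv e q (agents x y z mx my mz) := by
  have hs := h.sum
  refine Serv.of_forall h.le fun S hS => ?_
  rw [card_agents]
  have hN : t + (mx + my + mz) = N := by omega
  rcases mem_agents hS with ⟨rfl, h0⟩ | ⟨rfl, h0⟩ | ⟨rfl, h0⟩
  · exact Serv.of_seq (h.X h0) (by rw [hN]; exact F.hXq) fun j _ hj => F.hX j (by omega)
  · exact Serv.of_seq (h.Y h0) (by rw [hN]; exact F.hYq) fun j _ hj => F.hY j (by omega)
  · exact hz h0

/-- The full pieces of type `z` that remain. -/
theorem serv_full {p : ℤ} {r : ℕ} (hr : t + r + 1 ≤ N) (hp : p ≤ F.Z t) :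
    Serv p q (Multiset.replicate r z) := by
  have hmono : ∀ i, t + r + i + 1 ≤ N → F.Z (t + r) ≤ F.Z (t + r + i) := by
    intro i
    induction i with
    | zero => intro _; rfl
    | succ i ih => intro hi; exact (ih (by omega)).trans (F.hZ (t + r + i) (by omega)).1
  refine Serv.of_seq (X := F.Z) hp ?_ fun j _ hj => ?_
  · have h1 := hmono (N - 1 - (t + r)) (by omega)
    have h2 := F.hZq
    rw [show t + r + (N - 1 - (t + r)) = N - 1 by omega] at h1
    exact h1.trans h2
  · obtain ⟨h1, h2⟩ := F.hZ j (by omega)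
    exact ⟨h1, by linarith⟩

/-- Once the rest of the current piece is acceptable, type `z` is no longer short of a piece. -/
theorem State.serv_of_rest (h : F.State t e mx my mz) (hr : 3 / 4 ≤ F.rest t e) :
    Serv e q (agents x y z mx my mz) := by
  refine h.serv_of_forall fun hz => ?_
  have hs := h.sum
  rw [show mx + my + mz = (mx + my + mz - 1) + 1 by omega, Multiset.replicate_succ]
  exact .cons (h.Z hz) hr (serv_full (by omega) le_rfl)

/-- A position reached with `t + 1` agents served by giving the latest piece to an agent of type
`z`, who accepts it. It is the end of the next piece of type `x`, `y` or `z`. -/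
def GoodStep (F : Slots x y z N q) (t : ℕ) (e e' : ℤ) (mx my mz : ℕ) : Prop :=
  3 / 4 ≤ z.U e' - z.U e ∧ e ≤ e' ∧ F.State (t + 1) e' mx my mz ∧
    ((0 < mx ∧ e' = F.X (t + 1) ∧ F.Z t < e' ∧ e' ≤ F.Z (t + 1)) ∨
      (0 < my ∧ e' = F.Y (t + 1) ∧ F.Z t < e' ∧ e' ≤ F.Z (t + 1)) ∨ e' = F.Z (t + 1))

/-- The next piece of type `x` ends first, type `z` does not accept it, but loses little by
having it removed. -/
def BadStep (F : Slots x y z N q) (t : ℕ) (e : ℤ) (mx my mz : ℕ) : Prop :=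
  3 / 4 ≤ x.U (F.X (t + 1)) - x.U e ∧ e ≤ F.X (t + 1) ∧
    F.State (t + 1) (F.X (t + 1)) mx my mz ∧ F.X (t + 1) < F.Z (t + 1) ∧
    F.rest t e + 1 / 4 < F.rest (t + 1) (F.X (t + 1))

theorem GoodStep.swap {e' : ℤ} (h : F.swap.GoodStep t e e' my mx mz) :
    F.GoodStep t e e' mx my mz :=
  ⟨h.1, h.2.1, h.2.2.1.swap, by have := h.2.2.2; tauto⟩

/-- The step of the division in which the next piece of type `x` ends before that of type `y`. -/
theorem State.step_of_le (h : F.State t e (mx + 1) my (mz + 1))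
    (hle : 0 < my → F.X (t + 1) ≤ F.Y (t + 1)) :
    Serv e q (agents x y z (mx + 1) my (mz + 1)) ∨ (∃ e', F.GoodStep t e e' (mx + 1) my mz) ∨
      F.BadStep t e mx my (mz + 1) := by
  have hs := h.sum
  have heX := h.X (by omega)
  have heZ := h.Z (by omega)
  obtain ⟨hX1, hX2⟩ := F.hX t (by omega)
  obtain ⟨hZ1, hZ2⟩ := F.hZ t (by omega)
  have hxmono := x.mono heX
  have hzmono := z.mono heZ
  have hXq : F.X (t + 1) ≤ q :=
    (Serv.of_seq (S := x) (X := F.X) (i := t + 1) (r := mx + my + mz + 1) le_rfl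
      (by rw [show t + 1 + (mx + my + mz + 1) = N by omega]; exact F.hXq)
      fun j _ hj => F.hX j (by omega)).le
  have hst : ∀ k : ℕ, ∀ l : ℕ, k + l = mx + mz + 1 → F.X (t + 1) ≤ F.Z (t + 1) →
      F.State (t + 1) (F.X (t + 1)) k my l := fun k l hkl hXZ =>
    ⟨by omega, fun _ => le_rfl, hle, fun _ => hXZ, hXq⟩
  rcases le_or_gt (F.Z (t + 1)) (F.X (t + 1)) with hc | hc
  · refine .inr (.inl ⟨F.Z (t + 1), ?_, heZ.trans hZ1, ⟨by omega, fun _ => hc, fun h0 =>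
      hc.trans (hle h0), fun _ => le_rfl, hc.trans hXq⟩, .inr (.inr rfl)⟩)
    linarith
  rcases le_or_gt (F.X (t + 1)) (F.Z t) with hb | hb
  · left
    rw [agents_succ_left]
    refine .cons (heX.trans hX1) (by linarith) ((hst mx (mz + 1) (by omega)
      hc.le).serv_of_forall fun _ => ?_)
    exact serv_full (by omega) hb
  by_cases hg : 3 / 4 ≤ z.U (F.X (t + 1)) - z.U e
  · exact .inr (.inl ⟨_, hg, heX.trans hX1, hst (mx + 1) mz (by omega) hc.le,
      .inl ⟨by omega, rfl, hb, hc.le⟩⟩)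
  · refine .inr (.inr ⟨by linarith, heX.trans hX1, hst mx (mz + 1) (by omega) hc.le, hc, ?_⟩)
    simp only [rest]
    linarith

/-- One step of the division: either everybody left can be served at once, or the next piece goes
to an agent of type `z`, or it goes to the type whose piece ends first. -/
theorem State.step (h : F.State t e mx my (mz + 1)) (hpos : 0 < mx + my) :
    Serv e q (agents x y z mx my (mz + 1)) ∨ (∃ e', F.GoodStep t e e' mx my mz) ∨
      (∃ k, mx = k + 1 ∧ F.BadStep t e k my (mz + 1)) ∨
      (∃ k, my = k + 1 ∧ F.swap.BadStep t e k mx (mz + 1)) := by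
  by_cases hx : 0 < mx ∧ (0 < my → F.X (t + 1) ≤ F.Y (t + 1))
  · obtain ⟨k, rfl⟩ : ∃ k, mx = k + 1 := ⟨mx - 1, by omega⟩
    rcases h.step_of_le hx.2 with h1 | h1 | h1
    · exact .inl h1
    · exact .inr (.inl h1)
    · exact .inr (.inr (.inl ⟨k, rfl, h1⟩))
  · obtain ⟨k, rfl⟩ : ∃ k, my = k + 1 := ⟨my - 1, by
      by_contra h0
      exact hx ⟨by omega, fun _ => by omega⟩⟩
    have hle : 0 < mx → F.swap.X (t + 1) ≤ F.swap.Y (t + 1) := by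
      intro h0
      by_contra hlt
      exact hx ⟨h0, fun _ => (not_le.1 hlt).le⟩
    rcases h.swap.step_of_le hle with h1 | ⟨e', h1⟩ | h1
    · left
      rwa [agents_swap]
    · exact .inr (.inl ⟨e', h1.swap⟩)
    · exact .inr (.inr (.inr ⟨k, rfl, h1⟩))

theorem GoodStep.serv {e' : ℤ} (h : F.GoodStep t e e' mx my mz)
    (hs : Serv e' q (agents x y z mx my mz)) : Serv e q (agents x y z mx my (mz + 1)) := by
  rw [agents_succ_right]
  exact .cons h.2.1 h.1 hs

theorem GoodStep.rest_nonneg {e' : ℤ} (h : F.GoodStep t e e' mx my mz) :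
    0 ≤ F.rest (t + 1) e' := by
  have : e' ≤ F.Z (t + 1) := by rcases h.2.2.2 with h | h | h <;> omega
  simpa [rest] using z.mono this

theorem BadStep.serv (h : F.BadStep t e mx my mz)
    (hs : Serv (F.X (t + 1)) q (agents x y z mx my mz)) :
    Serv e q (agents x y z (mx + 1) my mz) := by
  rw [agents_succ_left]
  exact .cons h.2.1 h.1 hs

theorem State.serv_of_eq_zero (h : F.State t e mx my 0) : Serv e q (agents x y z mx my 0) :=
  h.serv_of_forall fun h0 => absurd h0 (lt_irrefl _)

/-- Among three consecutive pieces one is accepted by type `z`, so `mz ≤ (mx + my) / 2` agents of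
type `z` can be served, with a correction that depends on the rest of the current piece. -/
theorem State.serv_of_two_mul_le (h : F.State t e mx my mz) (hr : 0 ≤ F.rest t e)
    (hc : mz = 0 ∨ 2 * mz + 1 ≤ mx + my ∨ (2 * mz ≤ mx + my ∧ 1 / 4 < F.rest t e) ∨
      (2 * mz ≤ mx + my + 1 ∧ 1 / 2 ≤ F.rest t e)) :
    Serv e q (agents x y z mx my mz) := by
  induction hk : mx + my + mz generalizing t e mx my mz with
  | zero =>
    obtain rfl : mz = 0 := by omega
    exact h.serv_of_eq_zero
  | succ r ih =>
    rcases mz with _ | mz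
    · exact h.serv_of_eq_zero
    rcases h.step (by omega) with h1 | ⟨e', h1⟩ | ⟨k, rfl, h1⟩ | ⟨k, rfl, h1⟩
    · exact h1
    · exact h1.serv (ih h1.2.2.1 h1.rest_nonneg (by omega) (by omega))
    · by_cases hall : 3 / 4 ≤ F.rest (t + 1) (F.X (t + 1))
      · exact h1.serv (h1.2.2.1.serv_of_rest hall)
      have hlt := h1.2.2.2.2
      refine h1.serv (ih h1.2.2.1 (by linarith) (.inr ?_) (by omega))
      rcases hc with hc | hc | hc | hc
      · omega
      · exact .inr (.inl ⟨by omega, by linarith⟩)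
      · exact .inr (.inr ⟨by omega, by linarith⟩)
      · exact absurd (by linarith) hall
    · rw [agents_swap]
      have hst := h1.2.2.1.swap
      change F.State (t + 1) (F.Y (t + 1)) mx k (mz + 1) at hst
      by_cases hall : 3 / 4 ≤ F.rest (t + 1) (F.Y (t + 1))
      · exact h1.serv (by rw [agents_swap]; exact hst.serv_of_rest hall)
      have hlt := h1.2.2.2.2
      change F.rest t e + 1 / 4 < F.rest (t + 1) (F.Y (t + 1)) at hlt
      refine h1.serv ?_
      change Serv (F.Y (t + 1)) q _
      rw [agents_swap]
      refine ih hst (by linarith) (.inr ?_) (by omega)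
      rcases hc with hc | hc | hc | hc
      · omega
      · exact .inr (.inl ⟨by omega, by linarith⟩)
      · exact .inr (.inr ⟨by omega, by linarith⟩)
      · exact absurd (by linarith) hall

/-- If type `z` does not accept cuts of the types `x` and `y`, and no piece of these types lies
within a piece of type `z`, then of two consecutive pieces one is accepted by type `z`. -/
theorem State.serv_of_le_add (h : F.State t e mx my mz)
    (hx : ∀ j, j + 1 < N → F.Z j < F.X (j + 1) → F.X (j + 1) ≤ F.Z (j + 1) →
      1 / 4 < F.rest (j + 1) (F.X (j + 1)))
    (hy : ∀ j, j + 1 < N → F.Z j < F.Y (j + 1) → F.Y (j + 1) ≤ F.Z (j + 1) →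
      1 / 4 < F.rest (j + 1) (F.Y (j + 1)))
    (hxz : ∀ j, j + 2 < N → F.Z (j + 1) ≤ F.X (j + 1) → F.Z (j + 2) ≤ F.X (j + 2))
    (hyz : ∀ j, j + 2 < N → F.Z (j + 1) ≤ F.Y (j + 1) → F.Z (j + 2) ≤ F.Y (j + 2))
    (hc : mz = 0 ∨ (mz + 1 ≤ mx + my ∧ (1 / 4 < F.rest t e ∨
        (t + 1 < N → (0 < mx → F.Z (t + 1) ≤ F.X (t + 1)) ∧
          (0 < my → F.Z (t + 1) ≤ F.Y (t + 1))))) ∨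
      (mz ≤ mx + my ∧ 1 / 2 ≤ F.rest t e)) :
    Serv e q (agents x y z mx my mz) := by
  induction hk : mx + my + mz generalizing t e mx my mz with
  | zero =>
    obtain rfl : mz = 0 := by omega
    exact h.serv_of_eq_zero
  | succ r ih =>
    rcases mz with _ | mz
    · exact h.serv_of_eq_zero
    have hs := h.sum
    rcases h.step (by omega) with h1 | ⟨e', h1⟩ | ⟨k, rfl, h1⟩ | ⟨k, rfl, h1⟩
    · exact h1
    · refine h1.serv (ih h1.2.2.1 ?_ (by omega))
      refine .inr (.inl ⟨by omega, ?_⟩)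
      rcases h1.2.2.2 with ⟨h0, rfl, h2, h3⟩ | ⟨h0, rfl, h2, h3⟩ | rfl
      · exact .inl (hx t (by omega) h2 h3)
      · exact .inl (hy t (by omega) h2 h3)
      · exact .inr fun hN => ⟨fun h0 => hxz t hN (h1.2.2.1.X h0),
          fun h0 => hyz t hN (h1.2.2.1.Y h0)⟩
    · by_cases hall : 3 / 4 ≤ F.rest (t + 1) (F.X (t + 1))
      · exact h1.serv (h1.2.2.1.serv_of_rest hall)
      have hlt := h1.2.2.2.2
      refine h1.serv (ih h1.2.2.1 (.inr (.inr ?_)) (by omega))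
      rcases hc with hc | ⟨hc, hc' | hc'⟩ | hc
      · omega
      · exact ⟨by omega, by linarith⟩
      · have := (hc' (by omega)).1 (by omega)
        have := h1.2.2.2.1
        omega
      · exact absurd (by linarith) hall
    · rw [agents_swap]
      have hst := h1.2.2.1.swap
      change F.State (t + 1) (F.Y (t + 1)) mx k (mz + 1) at hst
      by_cases hall : 3 / 4 ≤ F.rest (t + 1) (F.Y (t + 1))
      · exact h1.serv (by rw [agents_swap]; exact hst.serv_of_rest hall)
      have hlt := h1.2.2.2.2
      change F.rest t e + 1 / 4 < F.rest (t + 1) (F.Y (t + 1)) at hlt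
      refine h1.serv ?_
      change Serv (F.Y (t + 1)) q _
      rw [agents_swap]
      refine ih hst (.inr (.inr ?_)) (by omega)
      rcases hc with hc | ⟨hc, hc' | hc'⟩ | hc
      · omega
      · exact ⟨by omega, by linarith⟩
      · have := (hc' (by omega)).2 (by omega)
        have : F.Y (t + 1) < F.Z (t + 1) := h1.2.2.2.1
        omega
      · exact absurd (by linarith) hall

/-- If type `z` does not accept cuts of type `x`, and whenever little of a piece is left to type
`z` the next piece of type `x` reaches beyond the next piece of type `z`, then the pieces that go
to agents of type `x` alternate with pieces that go to agents of type `z`. -/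
theorem State.serv_of_le (h : F.State t e mx my mz)
    (hx : ∀ j, j + 1 < N → F.Z j < F.X (j + 1) → F.X (j + 1) ≤ F.Z (j + 1) →
      1 / 4 < F.rest (j + 1) (F.X (j + 1)))
    (hxz : ∀ j, j + 2 < N → F.Z (j + 1) ≤ F.X (j + 1) → F.Z (j + 2) ≤ F.X (j + 2))
    (hyz : ∀ j, j + 2 < N → F.Z j < F.Y (j + 1) → F.Y (j + 1) ≤ F.Z (j + 1) →
      F.rest (j + 1) (F.Y (j + 1)) ≤ 1 / 4 → F.Y (j + 1) ≤ F.X (j + 1) →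
        F.Z (j + 1) ≤ F.X (j + 1))
    (hc : mz = 0 ∨ (mz + 1 ≤ mx ∧ (1 / 4 < F.rest t e ∨
        (t + 1 < N → F.Z (t + 1) ≤ F.X (t + 1)))) ∨
      (mz ≤ mx ∧ 1 / 2 ≤ F.rest t e)) :
    Serv e q (agents x y z mx my mz) := by
  induction hk : mx + my + mz generalizing t e mx my mz with
  | zero =>
    obtain rfl : mz = 0 := by omega
    exact h.serv_of_eq_zero
  | succ r ih =>
    rcases mz with _ | mz
    · exact h.serv_of_eq_zero
    have hs := h.sum
    rcases h.step (by omega) with h1 | ⟨e', h1⟩ | ⟨k, rfl, h1⟩ | ⟨k, rfl, h1⟩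
    · exact h1
    · refine h1.serv (ih h1.2.2.1 ?_ (by omega))
      refine .inr (.inl ⟨by omega, ?_⟩)
      rcases h1.2.2.2 with ⟨h0, rfl, h2, h3⟩ | ⟨h0, rfl, h2, h3⟩ | rfl
      · exact .inl (hx t (by omega) h2 h3)
      · by_cases hle : 1 / 4 < F.rest (t + 1) (F.Y (t + 1))
        · exact .inl hle
        · exact .inr fun hN => hxz t hN (hyz t hN h2 h3 (not_lt.1 hle)
            (h1.2.2.1.X (by omega)))
      · exact .inr fun hN => hxz t hN (h1.2.2.1.X (by omega))
    · by_cases hall : 3 / 4 ≤ F.rest (t + 1) (F.X (t + 1))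
      · exact h1.serv (h1.2.2.1.serv_of_rest hall)
      have hlt := h1.2.2.2.2
      refine h1.serv (ih h1.2.2.1 (.inr (.inr ?_)) (by omega))
      rcases hc with hc | ⟨hc, hc' | hc'⟩ | hc
      · omega
      · exact ⟨by omega, by linarith⟩
      · have := hc' (by omega)
        have := h1.2.2.2.1
        omega
      · exact absurd (by linarith) hall
    · rw [agents_swap]
      have hst := h1.2.2.1.swap
      change F.State (t + 1) (F.Y (t + 1)) mx k (mz + 1) at hst
      have hlt := h1.2.2.2.2
      change F.rest t e + 1 / 4 < F.rest (t + 1) (F.Y (t + 1)) at hlt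
      have hr : 0 ≤ F.rest t e := by simpa [rest] using z.mono (h.Z (by omega))
      refine h1.serv ?_
      change Serv (F.Y (t + 1)) q _
      rw [agents_swap]
      by_cases hall : 3 / 4 ≤ F.rest (t + 1) (F.Y (t + 1))
      · exact hst.serv_of_rest hall
      refine ih hst (.inr ?_) (by omega)
      rcases hc with hc | ⟨hc, hc'⟩ | hc
      · omega
      · exact .inl ⟨hc, .inl (by linarith)⟩
      · exact absurd (by linarith) hall

end Slots

/-! ### Positions and stretches shared by the pieces of several types -/

namespace Cutting

variable {m n : ℕ}

/-- Cutting the cycle open at `e` leaves `n` disjoint pieces worth at least `3 / 4`: the larger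
part of the piece that contains `e` is still worth that much. -/
def Good (S : Cutting m n) (e : ℤ) : Prop :=
  ∃ k, S.cut k ≤ e ∧ e ≤ S.cut (k + 1) ∧
    (3 / 4 ≤ S.U e - S.U (S.cut k) ∨ 3 / 4 ≤ S.U (S.cut (k + 1)) - S.U e)

/-- The stretch from `p` to `q` lies within one piece. -/
def Within (S : Cutting m n) (p q : ℤ) : Prop := ∃ k, S.cut k ≤ p ∧ q ≤ S.cut (k + 1)

theorem Within.mono {S : Cutting m n} {p q p' q' : ℤ} (h : S.Within p q) (hp : p ≤ p')
    (hq : q' ≤ q) : S.Within p' q' := by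
  obtain ⟨k, h1, h2⟩ := h
  exact ⟨k, h1.trans hp, hq.trans h2⟩

theorem within_cut (S : Cutting m n) (k : ℤ) : S.Within (S.cut k) (S.cut (k + 1)) :=
  ⟨k, le_rfl, le_rfl⟩

theorem good_cut (S : Cutting m n) (k : ℤ) : S.Good (S.cut k) :=
  ⟨k, le_rfl, (S.strictMono_cut (by omega)).le, .inr (by linarith [S.one_le k])⟩

theorem Good.reflect {S : Cutting m n} {e : ℤ} (h : S.Good e) : S.reflect.Good (-e) := by
  obtain ⟨k, h1, h2, h3⟩ := h
  refine ⟨-(k + 1), by simpa using h2, by simpa using h1, ?_⟩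
  simp only [reflect_U, reflect_cut, neg_neg, neg_add_rev, neg_add_cancel_comm]
  rcases h3 with h3 | h3
  · exact .inr (by linarith)
  · exact .inl (by linarith)

theorem Within.reflect {S : Cutting m n} {p q : ℤ} (h : S.Within p q) :
    S.reflect.Within (-q) (-p) := by
  obtain ⟨k, h1, h2⟩ := h
  refine ⟨-(k + 1), by simpa using h2, ?_⟩
  simpa using h1

theorem good_of_reflect {S : Cutting m n} {e : ℤ} (h : S.reflect.Good e) : S.Good (-e) := by
  simpa using h.reflect

theorem within_of_reflect {S : Cutting m n} {p q : ℤ} (h : S.reflect.Within p q) :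
    S.Within (-q) (-p) := by
  simpa using h.reflect

/-- The positions `X 0, …, X N` bound `N` pieces, worth at least `3 / 4` each, between `s` and
`f`; except for the first and the last one they are cuts. -/
structure Run (S : Cutting m n) (s f : ℤ) (N : ℕ) (X : ℕ → ℤ) : Prop where
  start : s ≤ X 0
  finish : X N ≤ f
  piece : ∀ j < N, X j ≤ X (j + 1) ∧ 3 / 4 ≤ S.U (X (j + 1)) - S.U (X j)
  inner : ∃ k : ℤ, ∀ j : ℕ, 1 ≤ j → j < N → X j = S.cut (k + j)

theorem Run.serv {S : Cutting m n} {s f : ℤ} {N : ℕ} {X : ℕ → ℤ} (h : S.Run s f N X) :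
    Serv s f (Multiset.replicate N S) :=
  Serv.of_seq (i := 0) h.start (by simpa using h.finish) fun j _ hj => h.piece j (by omega)

theorem cut_piece (S : Cutting m n) (k : ℤ) :
    S.cut k ≤ S.cut (k + 1) ∧ 3 / 4 ≤ S.U (S.cut (k + 1)) - S.U (S.cut k) :=
  ⟨(S.strictMono_cut (by omega)).le, by linarith [S.one_le k]⟩

theorem Good.exists_run {S : Cutting m n} {e : ℤ} (hn : 1 ≤ n) (h : S.Good e) :
    ∃ X, S.Run e (e + m) n X := by
  obtain ⟨k, h1, h2, h3 | h3⟩ := h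
  · have hper := S.cut_period k
    refine ⟨fun j => if j < n then S.cut (k + 1 + j) else e + m, ?_, ?_, ?_, k + 1, ?_⟩
    · simpa [show 0 < n by omega] using h2
    · simp
    · intro j hj
      by_cases hj' : j + 1 < n
      · simp only [hj, hj', if_true]
        have := S.cut_piece (k + 1 + j)
        push_cast
        rwa [← add_assoc]
      · have hjn : k + 1 + (j : ℤ) = k + n := by omega
        simp only [hj, hj', if_true, if_false, hjn, hper]
        have := S.period (S.cut k) e
        exact ⟨by omega, by linarith⟩
    · intro j _ hj
      simp [hj]
  · have hper := S.cut_period k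
    refine ⟨fun j => if j = 0 then e else S.cut (k + j), ?_, ?_, ?_, k, ?_⟩
    · simp
    · simp only [show n ≠ 0 by omega, if_false, hper]
      omega
    · intro j hj
      rcases j with _ | j
      · simpa using ⟨h2, h3⟩
      · have := S.cut_piece (k + (j + 1 : ℕ))
        simpa [add_assoc] using this
    · intro j hj _
      simp [show j ≠ 0 by omega]

theorem Within.exists_run {S : Cutting m n} {p q : ℤ} (hn : 1 ≤ n) (h : S.Within p q) :
    ∃ X, S.Run q (p + m) (n - 1) X := by
  obtain ⟨k, h1, h2⟩ := h
  have hper := S.cut_period k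
  refine ⟨fun j => S.cut (k + 1 + j), by simpa using h2, ?_, ?_, k + 1, fun _ _ _ => rfl⟩
  · have : k + 1 + ((n - 1 : ℕ) : ℤ) = k + n := by omega
    rw [this, hper]
    omega
  · intro j _
    have := S.cut_piece (k + 1 + j)
    push_cast
    rwa [← add_assoc]

/-- If a piece of `x` lies within a piece of `y`, then, both having `n` pieces, also some piece
of `y` lies within a piece of `x`. -/
theorem exists_within_of_within {x y : Cutting m n} (hn : 1 ≤ n) {i : ℤ}
    (h : y.Within (x.cut i) (x.cut (i + 1))) : ∃ k, x.Within (y.cut k) (y.cut (k + 1)) := by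
  obtain ⟨l, h1, h2⟩ := h
  by_contra! hno
  have hstep : ∀ j : ℤ, x.cut (i + j) ≤ y.cut (l + j) →
      x.cut (i + j + 1) ≤ y.cut (l + j + 1) := by
    intro j hj
    by_contra! hlt
    exact hno (l + j) ⟨i + j, hj, hlt.le⟩
  have hind : ∀ j : ℕ, x.cut (i + (j + 1)) ≤ y.cut (l + (j + 1)) := by
    intro j
    induction j with
    | zero => simpa using h2
    | succ j ih =>
      have := hstep _ ih
      push_cast
      rwa [add_assoc i, add_assoc l] at this
  have hx := x.cut_period i
  have hy := y.cut_period l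
  -- after one turn around the cycle the cuts with which the comparison began are compared again
  have hle : x.cut i ≤ y.cut l := by
    have := hind (n - 1)
    rw [show ((n - 1 : ℕ) : ℤ) + 1 = n by omega, hx, hy] at this
    omega
  have hpre : x.cut (i + (n - 1 : ℕ)) ≤ y.cut (l + (n - 1 : ℕ)) := by
    rcases Nat.lt_or_ge 1 n with h | h
    · have := hind (n - 2)
      rwa [show ((n - 2 : ℕ) : ℤ) + 1 = (n - 1 : ℕ) by omega] at this
    · simpa [show n - 1 = 0 by omega] using hle
  refine hno (l + (n - 1 : ℕ)) ⟨i + (n - 1 : ℕ), hpre, ?_⟩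
  rw [show l + ((n - 1 : ℕ) : ℤ) + 1 = l + n by omega,
    show i + ((n - 1 : ℕ) : ℤ) + 1 = i + n by omega, hx, hy]
  omega

end Cutting

open Cutting

section Stuck

variable {m n : ℕ} {x y z : Cutting m n}

theorem solvable_of_good {M : Multiset (Cutting m n)} (hn : 1 ≤ n) (hM : Multiset.card M = n)
    {e : ℤ} (h : ∀ S ∈ M, S.Good e) : Solvable M := by
  refine ⟨e, Serv.of_forall (by omega) fun S hS => ?_⟩
  obtain ⟨X, hX⟩ := (h S hS).exists_run hn
  rw [hM]
  exact hX.serv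

/-- A stretch that suffices for one agent and does not cut into two pieces of anybody can be
given to this agent. -/
theorem solvable_of_within {M : Multiset (Cutting m n)} (hn : 1 ≤ n) (hM : Multiset.card M = n)
    {p q : ℤ} (h : ∀ S ∈ M, S.Within p q) {w : Cutting m n} (hw : w ∈ M)
    (hval : 3 / 4 ≤ w.U q - w.U p) : Solvable M := by
  have hpq : p ≤ q := by
    by_contra! hlt
    have := w.mono hlt.le
    linarith
  obtain ⟨M', rfl⟩ := Multiset.exists_cons_of_mem hw
  have hM' : Multiset.card M' = n - 1 := by
    rw [Multiset.card_cons] at hM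
    omega
  have hend : q ≤ p + m := by
    obtain ⟨X, hX⟩ := (h w hw).exists_run hn
    exact hX.serv.le
  refine ⟨p, .cons hpq hval (Serv.of_forall hend fun S hS => ?_)⟩
  obtain ⟨X, hX⟩ := (h S (Multiset.mem_cons_of_mem hS)).exists_run hn
  rw [hM']
  exact hX.serv

/-- The situation in which neither `solvable_of_good` nor `solvable_of_within` applies to the
types `x`, `y`, `z`. -/
structure Stuck (x y z : Cutting m n) : Prop where
  good : ∀ e, x.Good e → y.Good e → ¬ z.Good e
  thin : ∀ p q, x.Within p q → y.Within p q → z.Within p q →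
    x.U q - x.U p < 3 / 4 ∧ y.U q - y.U p < 3 / 4 ∧ z.U q - z.U p < 3 / 4

theorem Stuck.swap (h : Stuck x y z) : Stuck y x z :=
  ⟨fun e hy hx => h.good e hx hy, fun p q hy hx hz => by have := h.thin p q hx hy hz; tauto⟩

theorem Stuck.rotate (h : Stuck x y z) : Stuck y z x :=
  ⟨fun e hy hz hx => h.good e hx hy hz, fun p q hy hz hx => by
    have := h.thin p q hx hy hz; tauto⟩

theorem Stuck.reflect (h : Stuck x y z) : Stuck x.reflect y.reflect z.reflect := by
  refine ⟨fun e hx hy hz => h.good (-e) (good_of_reflect hx) (good_of_reflect hy)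
    (good_of_reflect hz), fun p q hx hy hz => ?_⟩
  have := h.thin (-q) (-p) (within_of_reflect hx) (within_of_reflect hy) (within_of_reflect hz)
  simp only [reflect_U]
  refine ⟨?_, ?_, ?_⟩ <;> linarith

theorem stuck_of_not_solvable {M : Multiset (Cutting m n)} (hn : 1 ≤ n)
    (hM : Multiset.card M = n) (h : ∀ S, S ∈ M ↔ S = x ∨ S = y ∨ S = z) (hs : ¬ Solvable M) :
    Stuck x y z := by
  refine ⟨fun e hx hy hz => hs (solvable_of_good hn hM (e := e) fun S hS => ?_),
    fun p q hx hy hz => ?_⟩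
  · rcases (h S).1 hS with rfl | rfl | rfl <;> assumption
  · have hw : ∀ S ∈ M, S.Within p q := by
      intro S hS
      rcases (h S).1 hS with rfl | rfl | rfl <;> assumption
    have hall : ∀ w ∈ M, w.U q - w.U p < 3 / 4 := by
      intro w hwM
      by_contra! hval
      exact hs (solvable_of_within hn hM hw hwM hval)
    exact ⟨hall x ((h x).2 (by simp)), hall y ((h y).2 (by simp)), hall z ((h z).2 (by simp))⟩

/-- A stretch within pieces of `x` and `y` that suffices for one of the types contains exactly
one cut of `z`, and its two parts are too small for `z`. -/
theorem Stuck.exists_cut (h : Stuck x y z) {p q : ℤ} (hx : x.Within p q) (hy : y.Within p q)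
    (hval : 3 / 4 ≤ x.U q - x.U p ∨ 3 / 4 ≤ y.U q - y.U p ∨ 3 / 4 ≤ z.U q - z.U p) :
    ∃ k, z.cut (k - 1) ≤ p ∧ p < z.cut k ∧ z.cut k < q ∧ q ≤ z.cut (k + 1) ∧
      z.U (z.cut k) - z.U p < 3 / 4 ∧ z.U q - z.U (z.cut k) < 3 / 4 := by
  obtain ⟨k, h1, h2⟩ := z.exists_cut_le_lt p
  have h3 : z.cut (k + 1) < q := by
    by_contra! hle
    have := h.thin p q hx hy ⟨k, h1, hle⟩
    rcases hval with hval | hval | hval <;> linarith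
  have h4 : q ≤ z.cut (k + 1 + 1) := by
    by_contra! hlt
    have h5 := h.thin (z.cut (k + 1)) (z.cut (k + 1 + 1)) (hx.mono h2.le hlt.le)
      (hy.mono h2.le hlt.le) (z.within_cut _)
    linarith [z.one_le (k + 1)]
  refine ⟨k + 1, by simpa using h1, h2, h3, h4, ?_, ?_⟩
  · exact (h.thin _ _ (hx.mono le_rfl h3.le) (hy.mono le_rfl h3.le) ⟨k, h1, le_rfl⟩).2.2
  · exact (h.thin _ _ (hx.mono h2.le le_rfl) (hy.mono h2.le le_rfl) ⟨k + 1, le_rfl, h4⟩).2.2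

end Stuck

/-! ### Starting points for the division -/

section Engine

variable {m n : ℕ} {x y z : Cutting m n} {AV AL : ℕ → ℕ → ℕ → Prop}

/-- The slots obtained from runs of `x` and `y` and the pieces of `z` from number `k` on. -/
def slotsOfRun {s f : ℤ} {N : ℕ} {X Y : ℕ → ℤ} (hX : x.Run s f N X) (hY : y.Run s f N Y)
    (k : ℤ) (hk : z.cut (k + (N - 1 : ℕ)) ≤ f) : Slots x y z N f where
  X := X
  Y := Y
  Z j := z.cut (k + j)
  hX := hX.piece
  hY := hY.piece
  hZ j _ := by
    push_cast
    rw [← add_assoc]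
    exact ⟨(z.cut_piece _).1, z.one_le _⟩
  hXq := hX.finish
  hYq := hY.finish
  hZq := hk

/-- A way to divide stretches on which `x` and `y` have as many pieces as there are agents and `z`
has one piece less: it works for `mx`, `my`, `mz` agents of the three types if `AV mx my mz` and at
least half a piece is left to `z` at the left end, or if `AL mx my mz` and more than a quarter is
left. -/
def Engine (x y z : Cutting m n) (AV AL : ℕ → ℕ → ℕ → Prop) : Prop :=
  ∀ (s f : ℤ) (N : ℕ) (X Y : ℕ → ℤ) (k : ℤ) (mx my mz : ℕ), x.Run s f N X → y.Run s f N Y →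
    s ≤ z.cut k → z.cut (k + (N - 1 : ℕ)) ≤ f → mx + my + mz = N →
    (AV mx my mz ∧ 1 / 2 ≤ z.U (z.cut k) - z.U s ∨
      AL mx my mz ∧ 1 / 4 < z.U (z.cut k) - z.U s) →
    Serv s f (Slots.agents x y z mx my mz)

theorem state_slotsOfRun {s f : ℤ} {N : ℕ} {X Y : ℕ → ℤ} (hX : x.Run s f N X)
    (hY : y.Run s f N Y) {k : ℤ} (hk : z.cut (k + (N - 1 : ℕ)) ≤ f) (hs : s ≤ z.cut k)
    {mx my mz : ℕ} (hN : mx + my + mz = N) :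
    (slotsOfRun (z := z) hX hY k hk).State 0 s mx my mz where
  sum := by omega
  X _ := hX.start
  Y _ := hY.start
  Z _ := by simpa [slotsOfRun] using hs
  le := hX.serv.le

theorem map_reflect_agents (x y z : Cutting m n) (mx my mz : ℕ) :
    (Slots.agents x y z mx my mz).map Cutting.reflect =
      Slots.agents x.reflect y.reflect z.reflect mx my mz := by
  simp [Slots.agents]

theorem Engine.solvable_of_good_right (hE : Engine x y z AV AL) (hn : 1 ≤ n) {mx my mz : ℕ}
    (hcard : mx + my + mz = n) (hAV : AV mx my mz) {e k : ℤ} (hx : x.Good e) (hy : y.Good e)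
    (hk : z.cut k ≤ e) (hk' : e ≤ z.cut (k + 1))
    (hrest : 1 / 2 ≤ z.U (z.cut (k + 1)) - z.U e) :
    Solvable (Slots.agents x y z mx my mz) := by
  obtain ⟨X, hX⟩ := hx.exists_run hn
  obtain ⟨Y, hY⟩ := hy.exists_run hn
  refine ⟨e, hE _ _ _ _ _ (k + 1) mx my mz hX hY hk' ?_ hcard (.inl ⟨hAV, hrest⟩)⟩
  rw [show k + 1 + ((n - 1 : ℕ) : ℤ) = k + n by omega, z.cut_period]
  omega

/-- The division can start at a position that is good for `x` and `y`: for `z` one of the two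
sides of this position is worth at least `1 / 2`. -/
theorem Engine.solvable_of_good (hE : Engine x y z AV AL)
    (hE' : Engine x.reflect y.reflect z.reflect AV AL) (hn : 1 ≤ n) {mx my mz : ℕ}
    (hcard : mx + my + mz = n) (hAV : AV mx my mz) {e : ℤ} (hx : x.Good e) (hy : y.Good e) :
    Solvable (Slots.agents x y z mx my mz) := by
  obtain ⟨k, hk, hk'⟩ := z.exists_cut_le_lt e
  have h1 := z.one_le k
  by_cases hrest : 1 / 2 ≤ z.U (z.cut (k + 1)) - z.U e
  · exact hE.solvable_of_good_right hn hcard hAV hx hy hk hk'.le hrest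
  · refine Solvable.of_reflect ?_
    rw [map_reflect_agents]
    refine hE'.solvable_of_good_right hn hcard hAV hx.reflect hy.reflect (k := -(k + 1)) ?_ ?_ ?_
    · simpa using hk'.le
    · simpa using hk
    · simp only [reflect_U, reflect_cut, neg_neg, neg_add_rev, neg_add_cancel_comm]
      linarith

theorem Engine.serv_of_within (hE : Engine x y z AV AL) (hn : 1 ≤ n) {mx my mz : ℕ}
    (hcard : mx + my + mz + 1 = n) (hpos : 0 < mx + my + mz) {p q k : ℤ} (hx : x.Within p q)
    (hy : y.Within p q) (hk : z.cut (k - 1) ≤ p) (hk' : q ≤ z.cut (k + 1))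
    (hrest : AV mx my mz ∧ 1 / 2 ≤ z.U (z.cut (k + 1)) - z.U q ∨
      AL mx my mz ∧ 1 / 4 < z.U (z.cut (k + 1)) - z.U q) :
    Serv q (p + m) (Slots.agents x y z mx my mz) := by
  obtain ⟨X, hX⟩ := hx.exists_run hn
  obtain ⟨Y, hY⟩ := hy.exists_run hn
  refine hE _ _ _ _ _ (k + 1) mx my mz hX hY hk' ?_ (by omega) hrest
  rw [show k + 1 + ((n - 1 - 1 : ℕ) : ℤ) = k - 1 + n by omega, z.cut_period]
  omega

/-- The division can start by giving an agent of type `z` a stretch within pieces of `x` and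
`y`. -/
theorem Engine.solvable_of_within_right (hE : Engine x y z AV AL) (hS : Stuck x y z)
    (hn : 1 ≤ n) {mx my mz : ℕ} (hcard : mx + my + mz + 1 = n) (hpos : 0 < mx + my + mz)
    (hAL : AL mx my mz) {p q : ℤ} (hx : x.Within p q) (hy : y.Within p q)
    (hval : 3 / 4 ≤ z.U q - z.U p) : Solvable (Slots.agents x y z mx my (mz + 1)) := by
  obtain ⟨k, h1, h2, h3, h4, h5, h6⟩ := hS.exists_cut hx hy (.inr (.inr hval))
  refine ⟨p, ?_⟩
  rw [Slots.agents_succ_right]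
  refine .cons (h2.trans h3).le hval
    (hE.serv_of_within hn hcard hpos hx hy h1 h4 (.inr ⟨hAL, ?_⟩))
  linarith [z.one_le k]

theorem agents_succ_mid (x y z : Cutting m n) (mx my mz : ℕ) :
    Slots.agents x y z mx (my + 1) mz = y ::ₘ Slots.agents x y z mx my mz := by
  simp [Slots.agents, Multiset.replicate_succ]

/-- The division can start by giving a piece of `y` that lies within a piece of `x` to an agent of
type `y`, or to an agent of type `z` if the latter accepts it. -/
theorem Engine.solvable_of_within_mid (hE : Engine x y z AV AL)
    (hE' : Engine x.reflect y.reflect z.reflect AV AL) (hS : Stuck x y z)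
    (hn : 1 ≤ n) {mx my mz : ℕ} (hcard : mx + (my + 1) + (mz + 1) = n)
    (hAV : AV mx my (mz + 1)) (hAL : AL mx (my + 1) mz) {i : ℤ}
    (hx : x.Within (y.cut i) (y.cut (i + 1))) :
    Solvable (Slots.agents x y z mx (my + 1) (mz + 1)) := by
  have hy := y.within_cut i
  have hyval := y.one_le i
  by_cases hval : 3 / 4 ≤ z.U (y.cut (i + 1)) - z.U (y.cut i)
  · exact hE.solvable_of_within_right hS hn (by omega) (by omega) hAL hx hy hval
  obtain ⟨k, h1, h2, h3, h4, h5, h6⟩ := hS.exists_cut hx hy (.inr (.inl (by linarith)))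
  have hz1 := z.one_le k
  have hz2 := z.one_le (k - 1)
  rw [sub_add_cancel] at hz2
  by_cases hrest : 1 / 2 ≤ z.U (z.cut (k + 1)) - z.U (y.cut (i + 1))
  · refine ⟨y.cut i, ?_⟩
    rw [agents_succ_mid]
    exact .cons (h2.trans h3).le (by linarith)
      (hE.serv_of_within hn (by omega) (by omega) hx hy h1 h4 (.inl ⟨hAV, hrest⟩))
  · refine Solvable.of_reflect ?_
    rw [map_reflect_agents, agents_succ_mid]
    refine ⟨-y.cut (i + 1), .cons (neg_le_neg (h2.trans h3).le)
      (by simp only [reflect_U, neg_neg]; linarith)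
      (hE'.serv_of_within hn (by omega) (by omega) hx.reflect hy.reflect (k := -k) ?_ ?_
        (.inl ⟨hAV, ?_⟩))⟩
    · simpa [sub_eq_add_neg, add_comm] using h4
    · simpa [sub_eq_add_neg, add_comm] using h1
    · simp only [reflect_U, reflect_cut, neg_neg, neg_add_rev]
      rw [show -1 + k = k - 1 by ring]
      linarith

end Engine

/-! ### Alternating cuts and the division of stretches -/

section Alternate

variable {m n : ℕ} {x y z : Cutting m n}

/-- No position is good for both types, and no piece of one of them lies within a piece of the
other: the cuts of `x` and `y` alternate. -/
structure Alternate (x y : Cutting m n) : Prop where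
  good : ∀ e, x.Good e → ¬ y.Good e
  left : ∀ k, ¬ y.Within (x.cut k) (x.cut (k + 1))
  right : ∀ k, ¬ x.Within (y.cut k) (y.cut (k + 1))

theorem Alternate.symm (h : Alternate x y) : Alternate y x :=
  ⟨fun e hy hx => h.good e hx hy, h.right, h.left⟩

theorem Alternate.reflect (h : Alternate x y) : Alternate x.reflect y.reflect := by
  refine ⟨fun e hx hy => h.good (-e) (good_of_reflect hx) (good_of_reflect hy),
    fun k hk => h.left (-(k + 1)) ?_, fun k hk => h.right (-(k + 1)) ?_⟩
  all_goals simpa using within_of_reflect hk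

/-- Something is left to `y` on the right of a position that is good for `x`. -/
theorem Alternate.quarter_right (h : Alternate x y) {e k : ℤ} (he : x.Good e)
    (hk : e ≤ y.cut k) : 1 / 4 < y.U (y.cut k) - y.U e := by
  have h1 := y.one_le (k - 1)
  rw [sub_add_cancel] at h1
  rcases le_total e (y.cut (k - 1)) with h2 | h2
  · linarith [y.mono h2]
  · by_contra! hle
    exact h.good e he ⟨k - 1, h2, by simpa using hk, .inl (by linarith)⟩

theorem Alternate.quarter_left (h : Alternate x y) {e k : ℤ} (he : x.Good e)
    (hk : y.cut k ≤ e) : 1 / 4 < y.U e - y.U (y.cut k) := by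
  have h1 := y.one_le k
  rcases le_total (y.cut (k + 1)) e with h2 | h2
  · linarith [y.mono h2]
  · by_contra! hle
    exact h.good e he ⟨k, hk, h2, .inr (by linarith)⟩

end Alternate

section Engines

variable {m n : ℕ} {x y z : Cutting m n}

/-- Without assumptions on the cuts, about a third of the agents may be of type `z`. -/
theorem engine_of_two_mul_le (x y z : Cutting m n) :
    Engine x y z (fun mx my mz => 2 * mz ≤ mx + my + 1)
      (fun mx my mz => mz = 0 ∨ 2 * mz ≤ mx + my) := by
  intro s f N X Y k mx my mz hX hY hs hf hN hc
  have hst := state_slotsOfRun hX hY hf hs hN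
  have hr : (slotsOfRun hX hY k hf).rest 0 s = z.U (z.cut k) - z.U s := by
    simp [Slots.rest, slotsOfRun]
  refine hst.serv_of_two_mul_le ?_ ?_
  · rw [hr]
    linarith [z.mono hs]
  · rw [hr]
    tauto

/-- A cut of `x` within a piece of `z` leaves more than `1 / 4` to `z` on its right. -/
theorem inner_lt {s f : ℤ} {N : ℕ} {X : ℕ → ℤ} (hX : x.Run s f N X) {k : ℤ}
    (h : Alternate x z) {j : ℕ} (hj : j + 1 < N) (hle : X (j + 1) ≤ z.cut (k + (j + 1 : ℕ))) :
    1 / 4 < z.U (z.cut (k + (j + 1 : ℕ))) - z.U (X (j + 1)) := by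
  obtain ⟨i, hi⟩ := hX.inner
  rw [hi (j + 1) (by omega) hj] at hle ⊢
  exact h.quarter_right (x.good_cut _) hle

/-- A piece of `x` that begins after a cut of `z` reaches the next cut of `z`. -/
theorem inner_le {s f : ℤ} {N : ℕ} {X : ℕ → ℤ} (hX : x.Run s f N X) {k : ℤ}
    (h : Alternate x z) {j : ℕ} (hj : j + 2 < N) (hle : z.cut (k + (j + 1 : ℕ)) ≤ X (j + 1)) :
    z.cut (k + (j + 2 : ℕ)) ≤ X (j + 2) := by
  obtain ⟨i, hi⟩ := hX.inner
  rw [hi (j + 1) (by omega) (by omega)] at hle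
  rw [hi (j + 2) (by omega) hj]
  by_contra! hlt
  refine h.left (i + (j + 1 : ℕ)) ⟨k + (j + 1 : ℕ), hle, ?_⟩
  push_cast at hlt ⊢
  simp only [add_assoc] at hlt ⊢
  exact hlt.le

/-- If the cuts of both `x` and `y` alternate with those of `z`, about half of the agents may
be of type `z`. -/
theorem engine_of_alternate_both (hx : Alternate x z) (hy : Alternate y z) :
    Engine x y z (fun mx my mz => mz ≤ mx + my)
      (fun mx my mz => mz = 0 ∨ mz + 1 ≤ mx + my) := by
  intro s f N X Y k mx my mz hX hY hs hf hN hc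
  have hst := state_slotsOfRun hX hY hf hs hN
  have hr : (slotsOfRun hX hY k hf).rest 0 s = z.U (z.cut k) - z.U s := by
    simp [Slots.rest, slotsOfRun]
  refine hst.serv_of_le_add (fun j hj _ hle => inner_lt hX hx hj hle)
    (fun j hj _ hle => inner_lt hY hy hj hle) (fun j hj hle => inner_le hX hx hj hle)
    (fun j hj hle => inner_le hY hy hj hle) ?_
  rw [hr]
  tauto

/-- A cut of `y` that leaves little to `z` on its right is followed by a cut of `x` only after the
next cut of `z`: otherwise the part of the piece of `z` on its left, being worth `3 / 4` to `z`,
would lie within a piece of `x`. -/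
theorem Stuck.cut_le_of_le (hS : Stuck x y z) (h : Alternate x z) {i k l : ℤ}
    (h2 : y.cut i ≤ z.cut (k + 1))
    (hrest : z.U (z.cut (k + 1)) - z.U (y.cut i) ≤ 1 / 4) (h3 : y.cut i ≤ x.cut l) :
    z.cut (k + 1) ≤ x.cut l := by
  by_contra! hlt
  have hone := z.one_le k
  obtain ⟨a, ha, ha'⟩ := x.exists_cut_le_lt (z.cut k)
  rcases lt_or_ge (x.cut (a + 1)) (y.cut i) with hc | hc
  · have hal : a + 1 < l := x.strictMono_cut.lt_iff_lt.1 (hc.trans_le h3)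
    have := x.strictMono_cut.monotone (show a + 1 + 1 ≤ l by omega)
    exact h.left (a + 1) ⟨k, ha'.le, this.trans hlt.le⟩
  · have hx : x.Within (z.cut k) (y.cut i) := ⟨a, ha, hc⟩
    have hz : z.Within (z.cut k) (y.cut i) := ⟨k, le_rfl, h2⟩
    have hy1 := y.one_le (i - 1)
    rw [sub_add_cancel] at hy1
    rcases le_total (y.cut (i - 1)) (z.cut k) with hd | hd
    · have := hS.thin _ _ hx ⟨i - 1, hd, by simp⟩ hz
      linarith
    · have := hS.thin (y.cut (i - 1)) (y.cut i) (hx.mono hd le_rfl) ⟨i - 1, le_rfl, by simp⟩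
        (hz.mono hd le_rfl)
      linarith

/-- If only the cuts of `x` are known to alternate with those of `z`, there may be as many agents of
type `z` as of type `x`. -/
theorem engine_of_alternate (hS : Stuck x y z) (h : Alternate x z) :
    Engine x y z (fun mx _ mz => mz ≤ mx) (fun mx _ mz => mz = 0 ∨ mz + 1 ≤ mx) := by
  intro s f N X Y k mx my mz hX hY hs hf hN hc
  have hst := state_slotsOfRun hX hY hf hs hN
  have hr : (slotsOfRun hX hY k hf).rest 0 s = z.U (z.cut k) - z.U s := by
    simp [Slots.rest, slotsOfRun]
  refine hst.serv_of_le (fun j hj _ hle => inner_lt hX h hj hle)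
    (fun j hj hle => inner_le hX h hj hle) (fun j hj h1 h2 h3 h4 => ?_) ?_
  · obtain ⟨a, ha⟩ := hX.inner
    obtain ⟨b, hb⟩ := hY.inner
    simp only [slotsOfRun, Slots.rest, ha (j + 1) (by omega) (by omega),
      hb (j + 1) (by omega) (by omega)] at h1 h2 h3 h4 ⊢
    push_cast at h1 h2 h3 h4 ⊢
    rw [← add_assoc k] at h2 h3 ⊢
    exact hS.cut_le_of_le h h2 h3 h4
  · rw [hr]
    tauto

end Engines

/-! ### Giving everybody a piece of the same cutting -/

section Pure

variable {m n : ℕ} {x y z : Cutting m n}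

/-- If the cuts of `x` and `y` alternate, then `y` accepts one of any two consecutive pieces
of `x`. -/
theorem Alternate.accepts_or_accepts (h : Alternate x y) (i : ℤ) :
    3 / 4 ≤ y.U (x.cut (i + 1)) - y.U (x.cut i) ∨
      3 / 4 ≤ y.U (x.cut (i + 1 + 1)) - y.U (x.cut (i + 1)) := by
  by_contra! hbad
  obtain ⟨hb1, hb2⟩ := hbad
  obtain ⟨k, h1, h2⟩ := y.exists_cut_le_lt (x.cut i)
  have h3 : y.cut (k + 1) < x.cut (i + 1) := by
    by_contra! hle
    exact h.left i ⟨k, h1, hle⟩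
  have h4 : x.cut (i + 1) < y.cut (k + 1 + 1) := by
    by_contra! hle
    linarith [y.mono h2.le, y.mono hle, y.one_le (k + 1)]
  have h5 : y.cut (k + 1 + 1) < x.cut (i + 1 + 1) := by
    by_contra! hle
    exact h.left (i + 1) ⟨k + 1, h3.le, hle⟩
  have h6 : x.cut (i + 1 + 1) < y.cut (k + 1 + 1 + 1) := by
    by_contra! hle
    linarith [y.mono h4.le, y.mono hle, y.one_le (k + 1 + 1)]
  -- the part left to `y` would grow by more than `1 / 4` twice
  have hr := h.quarter_right (x.good_cut i) h2.le
  refine h.good _ (x.good_cut (i + 1 + 1)) ⟨k + 1 + 1, h5.le, h6.le, .inr ?_⟩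
  linarith [y.one_le (k + 1), y.one_le (k + 1 + 1)]

/-- If `y` and `z` accept one of any two consecutive pieces of `x`, and at least half of the agents
are of type `x`, then everybody can get a piece of `x`. -/
theorem serv_pieces {mx my mz : ℕ} (hle : my + mz ≤ mx)
    (hy : 0 < my → ∀ i, 3 / 4 ≤ y.U (x.cut (i + 1)) - y.U (x.cut i) ∨
      3 / 4 ≤ y.U (x.cut (i + 1 + 1)) - y.U (x.cut (i + 1)))
    (hz : 0 < mz → ∀ i, 3 / 4 ≤ z.U (x.cut (i + 1)) - z.U (x.cut i) ∨
      3 / 4 ≤ z.U (x.cut (i + 1 + 1)) - z.U (x.cut (i + 1))) (i : ℤ) :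
    Serv (x.cut i) (x.cut (i + (mx + my + mz : ℕ))) (Slots.agents x y z mx my mz) := by
  have hpair : ∀ (w : Cutting m n) (M : Multiset (Cutting m n)) (i q : ℤ),
      (3 / 4 ≤ w.U (x.cut (i + 1)) - w.U (x.cut i) ∨
        3 / 4 ≤ w.U (x.cut (i + 1 + 1)) - w.U (x.cut (i + 1))) →
      Serv (x.cut (i + 1 + 1)) q M → Serv (x.cut i) q (x ::ₘ w ::ₘ M) := by
    intro w M i q hw hM
    obtain ⟨h1, h2⟩ := x.cut_piece i
    obtain ⟨h3, h4⟩ := x.cut_piece (i + 1)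
    rcases hw with hw | hw
    · rw [Multiset.cons_swap]
      exact .cons h1 hw (.cons h3 h4 hM)
    · exact .cons h1 h2 (.cons h3 hw hM)
  induction hk : my + mz generalizing mx my mz i with
  | zero =>
    obtain rfl : my = 0 := by omega
    obtain rfl : mz = 0 := by omega
    have hr := Serv.of_seq (S := x) (X := fun j => x.cut (i + j)) (p := x.cut i)
      (q := x.cut (i + mx)) (i := 0) (r := mx) (by simp) (by simp) fun j _ _ => by
        have := x.cut_piece (i + j)
        push_cast
        rwa [← add_assoc]
    simpa [Slots.agents] using hr
  | succ r ih =>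
    obtain ⟨mx, rfl⟩ : ∃ k, mx = k + 1 := ⟨mx - 1, by omega⟩
    have hlast : ∀ t : ℕ, i + 1 + 1 + (t : ℤ) = i + (t + 2 : ℕ) := fun t => by push_cast; ring
    rcases my with _ | my
    · obtain ⟨mz, rfl⟩ : ∃ k, mz = k + 1 := ⟨mz - 1, by omega⟩
      have := ih (mx := mx) (my := 0) (mz := mz) (by omega) (by omega)
        (fun _ => hz (by omega)) (i + 1 + 1) (by omega)
      rw [Slots.agents_succ_left, Slots.agents_succ_right]
      refine hpair _ _ _ _ (hz (by omega) i) ?_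
      rwa [hlast, show mx + 0 + mz + 2 = mx + 1 + 0 + (mz + 1) by omega] at this
    · have := ih (mx := mx) (my := my) (mz := mz) (by omega) (fun _ => hy (by omega))
        hz (i + 1 + 1) (by omega)
      rw [Slots.agents_succ_left, agents_succ_mid]
      refine hpair _ _ _ _ (hy (by omega) i) ?_
      rwa [hlast, show mx + my + mz + 2 = mx + 1 + (my + 1) + mz by omega] at this

/-- If the cuts of all three types alternate, and no stretch within pieces of `x` and `z` suffices
for `y`, then `y` accepts every piece of `x`. -/
theorem accepts_of_alternate (hxy : Alternate x y) (hyz : Alternate y z) (hxz : Alternate x z)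
    (hthin : ∀ p q, x.Within p q → z.Within p q → y.U q - y.U p < 3 / 4) (i : ℤ) :
    3 / 4 ≤ y.U (x.cut (i + 1)) - y.U (x.cut i) := by
  by_contra! hbad
  obtain ⟨k, h1, h2⟩ := y.exists_cut_le_lt (x.cut i)
  have h3 : y.cut (k + 1) < x.cut (i + 1) := by
    by_contra! hle
    exact hxy.left i ⟨k, h1, hle⟩
  have h4 : x.cut (i + 1) < y.cut (k + 1 + 1) := by
    by_contra! hle
    linarith [y.mono h2.le, y.mono hle, y.one_le (k + 1)]
  have hr1 := hxy.quarter_right (x.good_cut i) h2.le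
  have hr2 := hxy.quarter_left (x.good_cut (i + 1)) h3.le
  have ho1 := y.one_le k
  have ho2 := y.one_le (k + 1)
  -- more than half a piece of `y` lies to the left of the piece of `x`
  have hL : 1 / 2 < y.U (x.cut i) - y.U (y.cut k) := by
    by_contra! hle
    refine hxy.good _ (x.good_cut (i + 1)) ⟨k + 1, h3.le, h4.le, .inr ?_⟩
    linarith
  -- and more than half a piece of `y` lies to its right
  have hR : 1 / 2 < y.U (y.cut (k + 1 + 1)) - y.U (x.cut (i + 1)) := by linarith
  have hleft : ∃ l, y.cut k < z.cut l ∧ z.cut l ≤ x.cut i := by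
    obtain ⟨l, hl, hl'⟩ := z.exists_cut_le_lt (y.cut k)
    refine ⟨l + 1, hl', ?_⟩
    by_contra! hlt
    have hx1 : x.cut (i - 1) ≤ y.cut k := by
      by_contra! h
      refine hxy.left (i - 1) ⟨k, h.le, ?_⟩
      rw [sub_add_cancel]
      exact h2.le
    have hval : 1 / 4 < y.U (y.cut k) - y.U (max (x.cut (i - 1)) (z.cut l)) := by
      rcases max_choice (x.cut (i - 1)) (z.cut l) with h | h <;> rw [h]
      · exact hxy.quarter_right (x.good_cut _) hx1
      · exact hyz.symm.quarter_right (z.good_cut _) hl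
    have := hthin (max (x.cut (i - 1)) (z.cut l)) (x.cut i)
      ⟨i - 1, le_max_left _ _, by simp⟩ ⟨l, le_max_right _ _, hlt.le⟩
    linarith
  have hright : ∃ l, x.cut (i + 1) ≤ z.cut l ∧ z.cut l < y.cut (k + 1 + 1) := by
    obtain ⟨l, hl, hl'⟩ := z.exists_cut_le_lt (y.cut (k + 1 + 1) - 1)
    refine ⟨l, ?_, by omega⟩
    by_contra! hlt
    have hx1 : y.cut (k + 1 + 1) ≤ x.cut (i + 1 + 1) := by
      by_contra! h
      exact hxy.left (i + 1) ⟨k + 1, h3.le, h.le⟩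
    have hval : 1 / 4 < y.U (min (x.cut (i + 1 + 1)) (z.cut (l + 1))) -
        y.U (y.cut (k + 1 + 1)) := by
      rcases min_choice (x.cut (i + 1 + 1)) (z.cut (l + 1)) with h | h <;> rw [h]
      · exact hxy.quarter_left (x.good_cut _) hx1
      · exact hyz.symm.quarter_left (z.good_cut _) (by omega)
    have := hthin (x.cut (i + 1)) (min (x.cut (i + 1 + 1)) (z.cut (l + 1)))
      ⟨i + 1, le_rfl, min_le_left _ _⟩ ⟨l, hlt.le, min_le_right _ _⟩
    linarith
  -- hence two consecutive cuts of `z` lie between two consecutive cuts of `y`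
  obtain ⟨l, hl, hl'⟩ := hleft
  obtain ⟨l', hr, hr'⟩ := hright
  obtain ⟨j, hj, hj'⟩ := z.exists_cut_le_lt (x.cut i)
  have hlj : l ≤ j := by
    have := z.strictMono_cut.lt_iff_lt.1 (hl'.trans_lt hj')
    omega
  have hj1 : y.cut k < z.cut j := hl.trans_le (z.strictMono_cut.monotone hlj)
  have hj2 : y.cut (k + 1) < z.cut (j + 1) := by
    by_contra! h
    exact hyz.right j ⟨k, hj1.le, h⟩
  have hj3 : z.cut (j + 1) < x.cut (i + 1) := by
    by_contra! h
    exact hxz.left i ⟨j, hj, h⟩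
  have hj4 : j + 1 < l' := z.strictMono_cut.lt_iff_lt.1 (hj3.trans_le hr)
  have hj5 := z.strictMono_cut.monotone (show j + 1 + 1 ≤ l' by omega)
  exact hyz.right (j + 1) ⟨k + 1, hj2.le, hj5.trans hr'.le⟩

end Pure

/-! ### Three types of agents -/

section ThreeTypes

variable {m n : ℕ} {x y z : Cutting m n}

/-- The case in which the cuts of the two most frequent types alternate. -/
theorem solvable_three_of_alternate (hn : 1 ≤ n) {a b c : ℕ} (hcard : a + b + c = n)
    (hab : b ≤ a) (hbc : c ≤ b) (hc : 1 ≤ c) (hS : Stuck x y z) (hxy : Alternate x y) :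
    Solvable (Slots.agents x y z a b c) := by
  obtain ⟨a, rfl⟩ : ∃ k, a = k + 1 := ⟨a - 1, by omega⟩
  obtain ⟨b, rfl⟩ : ∃ k, b = k + 1 := ⟨b - 1, by omega⟩
  obtain ⟨c, rfl⟩ : ∃ k, c = k + 1 := ⟨c - 1, by omega⟩
  have hyzx : Slots.agents x y z (a + 1) (b + 1) (c + 1) =
      Slots.agents y z x (b + 1) (c + 1) (a + 1) := by
    simp only [Slots.agents]
    abel
  have hxzy : Slots.agents x y z (a + 1) (b + 1) (c + 1) =
      Slots.agents x z y (a + 1) (c + 1) (b + 1) := by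
    simp only [Slots.agents]
    abel
  have hS2 : Stuck x z y := hS.swap.rotate
  have hS3 : Stuck y z x := hS.rotate
  -- the types `x` and `z`, dividing the pieces of `y`
  have hE2 := engine_of_alternate hS2 hxy
  have hE2' := engine_of_alternate hS2.reflect hxy.reflect
  by_cases h1 : ∃ e, x.Good e ∧ z.Good e
  · obtain ⟨e, h1, h2⟩ := h1
    rw [hxzy]
    exact hE2.solvable_of_good hE2' hn (by omega) (by omega) h1 h2
  by_cases h2 : ∃ k, x.Within (z.cut k) (z.cut (k + 1))
  · obtain ⟨i, h2⟩ := h2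
    rw [hxzy]
    exact hE2.solvable_of_within_mid hE2' hS2 hn (by omega) (by omega) (by omega) h2
  by_cases h3 : ∃ p q, x.Within p q ∧ z.Within p q ∧ 3 / 4 ≤ y.U q - y.U p
  · obtain ⟨p, q, h4, h5, h6⟩ := h3
    rw [hxzy]
    exact hE2.solvable_of_within_right hS2 hn (by omega) (by omega) (by omega) h4 h5 h6
  push Not at h1 h2 h3
  have hxz : Alternate x z := ⟨h1, fun k hk => by
    obtain ⟨l, hl⟩ := exists_within_of_within hn hk
    exact h2 l hl, h2⟩
  by_cases hbig : b + 1 + (c + 1) ≤ a + 1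
  · refine ⟨x.cut 0, ?_⟩
    have := serv_pieces hbig (fun _ => hxy.accepts_or_accepts) (fun _ => hxz.accepts_or_accepts) 0
    rwa [hcard, x.cut_period] at this
  have hE3 := engine_of_alternate_both hxy.symm hxz.symm
  have hE3' := engine_of_alternate_both hxy.symm.reflect hxz.symm.reflect
  by_cases h4 : ∃ e, y.Good e ∧ z.Good e
  · obtain ⟨e, h4, h5⟩ := h4
    rw [hyzx]
    exact hE3.solvable_of_good hE3' hn (by omega) (by omega) h4 h5
  by_cases h5 : ∃ k, y.Within (z.cut k) (z.cut (k + 1))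
  · obtain ⟨i, h5⟩ := h5
    rw [hyzx]
    exact hE3.solvable_of_within_mid hE3' hS3 hn (by omega) (by omega) (by omega) h5
  push Not at h4 h5
  have hyz : Alternate y z := ⟨h4, fun k hk => by
    obtain ⟨l, hl⟩ := exists_within_of_within hn hk
    exact h5 l hl, h5⟩
  have hE1 := engine_of_alternate_both hxz hyz
  by_cases h6 : ∃ p q, x.Within p q ∧ y.Within p q ∧ 3 / 4 ≤ z.U q - z.U p
  · obtain ⟨p, q, h7, h8, h9⟩ := h6
    exact hE1.solvable_of_within_right hS hn (by omega) (by omega) (by omega) h7 h8 h9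
  push Not at h6
  have hper := x.cut_period 0
  refine ⟨x.cut 0, Serv.of_forall (by omega) fun S hS => ?_⟩
  rw [Slots.card_agents, hcard, ← hper]
  refine Serv.of_seq (X := fun j => x.cut j) (i := 0) (by simp) (by simp) fun j _ _ => ?_
  push_cast
  refine ⟨(x.cut_piece j).1, ?_⟩
  rcases Slots.mem_agents hS with ⟨rfl, _⟩ | ⟨rfl, _⟩ | ⟨rfl, _⟩
  · exact (S.cut_piece j).2
  · exact accepts_of_alternate hxy hyz hxz h3 j
  · exact accepts_of_alternate hxz hyz.symm hxy h6 j

/-- The case in which the types are sorted by decreasing number of agents. -/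
theorem solvable_of_sorted (hn : 1 ≤ n) {a b c : ℕ} (hcard : a + b + c = n) (hab : b ≤ a)
    (hbc : c ≤ b) : Solvable (Slots.agents x y z a b c) := by
  by_contra hns
  have hM : Multiset.card (Slots.agents x y z a b c) = n := by rw [Slots.card_agents, hcard]
  rcases Nat.eq_zero_or_pos b with rfl | hb
  · obtain rfl : c = 0 := by omega
    have := serv_pieces (x := x) (y := y) (z := z) (mx := a) (my := 0) (mz := 0) (by omega)
      (fun h => absurd h (lt_irrefl _)) (fun h => absurd h (lt_irrefl _)) 0
    rw [hcard, x.cut_period] at this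
    exact hns ⟨_, this⟩
  rcases Nat.eq_zero_or_pos c with rfl | hc
  · have hmem : ∀ S ∈ Slots.agents x y z a b 0, S = x ∨ S = y := fun S hS => by
      rcases Slots.mem_agents hS with ⟨h, _⟩ | ⟨h, _⟩ | ⟨_, h⟩
      · exact .inl h
      · exact .inr h
      · exact absurd h (lt_irrefl _)
    have hright : ∀ k, ¬ x.Within (y.cut k) (y.cut (k + 1)) := by
      intro k hk
      refine hns (solvable_of_within hn hM (p := y.cut k) (q := y.cut (k + 1)) (w := y) ?_ ?_
        (y.cut_piece k).2)
      · intro S hS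
        rcases hmem S hS with rfl | rfl
        · exact hk
        · exact S.within_cut k
      · simp [Slots.agents, Multiset.mem_replicate, hb.ne']
    have halt : Alternate x y := by
      refine ⟨fun e hx hy => hns (solvable_of_good hn hM (e := e) fun S hS => ?_),
        fun k hk => ?_, hright⟩
      · rcases hmem S hS with rfl | rfl <;> assumption
      · obtain ⟨l, hl⟩ := exists_within_of_within hn hk
        exact hright l hl
    have := serv_pieces (x := x) (y := y) (z := z) (mx := a) (my := b) (mz := 0) (by omega)
      (fun _ => halt.accepts_or_accepts) (fun h => absurd h (lt_irrefl _)) 0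
    rw [hcard, x.cut_period] at this
    exact hns ⟨_, this⟩
  have hS : Stuck x y z := stuck_of_not_solvable hn hM (fun S => by
    simp [Slots.agents, Multiset.mem_replicate, hb.ne', hc.ne', (hb.trans_le hab).ne', or_assoc])
    hns
  obtain ⟨b, rfl⟩ : ∃ k, b = k + 1 := ⟨b - 1, by omega⟩
  obtain ⟨c, rfl⟩ : ∃ k, c = k + 1 := ⟨c - 1, by omega⟩
  have hE := engine_of_two_mul_le x y z
  have hE' := engine_of_two_mul_le x.reflect y.reflect z.reflect
  have hgood : ∀ e, x.Good e → ¬ y.Good e := fun e hx hy =>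
    hns (hE.solvable_of_good hE' hn hcard (by omega) hx hy)
  have hright : ∀ k, ¬ x.Within (y.cut k) (y.cut (k + 1)) := fun k hk =>
    hns (hE.solvable_of_within_mid hE' hS hn hcard (by omega) (by omega) hk)
  refine hns (solvable_three_of_alternate hn hcard hab hbc hc hS ⟨hgood, fun k hk => ?_, hright⟩)
  obtain ⟨l, hl⟩ := exists_within_of_within hn hk
  exact hright l hl

/-- Any `n` agents of three types can be served on the cycle. -/
theorem solvable_three (hn : 1 ≤ n) {a b c : ℕ} (hcard : a + b + c = n) :
    Solvable (Slots.agents x y z a b c) := by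
  rcases le_total a b with h1 | h1 <;> rcases le_total b c with h2 | h2 <;>
    rcases le_total a c with h3 | h3
  all_goals
    first
    | exact solvable_of_sorted hn hcard h1 h2
    | (have := solvable_of_sorted (x := x) (y := z) (z := y) hn (a := a) (b := c) (c := b)
        (by omega) (by omega) (by omega)
       convert this using 1; simp only [Slots.agents]; abel)
    | (have := solvable_of_sorted (x := y) (y := x) (z := z) hn (a := b) (b := a) (c := c)
        (by omega) (by omega) (by omega)
       convert this using 1; simp only [Slots.agents]; abel)
    | (have := solvable_of_sorted (x := y) (y := z) (z := x) hn (a := b) (b := c) (c := a)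
        (by omega) (by omega) (by omega)
       convert this using 1; simp only [Slots.agents]; abel)
    | (have := solvable_of_sorted (x := z) (y := x) (z := y) hn (a := c) (b := a) (c := b)
        (by omega) (by omega) (by omega)
       convert this using 1; simp only [Slots.agents]; abel)
    | (have := solvable_of_sorted (x := z) (y := y) (z := x) hn (a := c) (b := b) (c := a)
        (by omega) (by omega) (by omega)
       convert this using 1; simp only [Slots.agents]; abel)

end ThreeTypes

/-! ### Unrolling the cycle -/

section Unroll

variable {m : ℕ} [NeZero m]

/-- The node of the cycle that lies under the integer `p`. -/
def node (m : ℕ) [NeZero m] (p : ℤ) : Fin m :=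
  ⟨(p % m).toNat, by
    have hm : (0 : ℤ) < m := by exact_mod_cast NeZero.pos m
    have := Int.emod_lt_of_pos p hm
    have := Int.emod_nonneg p hm.ne'
    omega⟩

theorem node_val (p : ℤ) : ((node m p : ℕ) : ℤ) = p % m :=
  Int.toNat_of_nonneg (Int.emod_nonneg _ (by exact_mod_cast NeZero.ne m))

theorem node_eq_iff {p q : ℤ} : node m p = node m q ↔ (m : ℤ) ∣ q - p := by
  rw [Fin.ext_iff, ← @Nat.cast_inj ℤ, node_val, node_val, ← Int.modEq_iff_dvd, Int.ModEq]

theorem node_natCast (v : Fin m) : node m (v : ℕ) = v := by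
  rw [Fin.ext_iff, ← @Nat.cast_inj ℤ, node_val]
  exact_mod_cast Nat.mod_eq_of_lt v.2

theorem node_add_mul (p t : ℤ) : node m (p + t * m) = node m p :=
  node_eq_iff.2 ⟨-t, by ring⟩

theorem eq_of_node_eq {p q a : ℤ} (h : node m p = node m q) (hp : a ≤ p) (hp' : p < a + m)
    (hq : a ≤ q) (hq' : q < a + m) : p = q := by
  have := Int.eq_zero_of_abs_lt_dvd (node_eq_iff.1 h) (by rw [abs_lt]; constructor <;> omega)
  omega

theorem exists_node_eq (a : ℤ) (v : Fin m) : ∃ p, a ≤ p ∧ p < a + m ∧ node m p = v := by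
  have hm : (0 : ℤ) < m := by exact_mod_cast NeZero.pos m
  have h1 := Int.emod_nonneg (v - a) hm.ne'
  have h2 := Int.emod_lt_of_pos (v - a) hm
  refine ⟨a + (v - a) % m, by omega, by omega, ?_⟩
  rw [← node_natCast v, node_eq_iff, node_natCast]
  exact ⟨(v - a) / m, by linarith [Int.emod_add_mul_ediv (v - a) m]⟩

theorem val_sub_eq_one_iff {m : ℕ} (hm : 2 ≤ m) (u v : Fin m) :
    (u - v).val = 1 ↔ (m : ℤ) ∣ u - v - 1 := by
  have hm' : (1 : ℤ) % m = 1 := Int.emod_eq_of_lt (by norm_num) (by exact_mod_cast hm)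
  have : (u - v).val = 1 ↔ 1 ≡ ((m - v.val + u.val : ℕ) : ℤ) [ZMOD m] := by
    rw [Int.ModEq, hm', Fin.val_sub, ← @Nat.cast_inj ℤ, Int.natCast_mod, Nat.cast_one, eq_comm]
  rw [this, Int.modEq_iff_dvd]
  push_cast [v.2.le]
  rw [show (m : ℤ) - v + u - 1 = m + (u - v - 1) by ring, dvd_add_right (dvd_refl _)]

theorem node_sub_node (p q : ℤ) : (m : ℤ) ∣ (node m q : ℤ) - node m p - (q - p) := by
  rw [node_val, node_val]
  refine ⟨p / m - q / m, ?_⟩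
  linarith [Int.emod_add_mul_ediv p m, Int.emod_add_mul_ediv q m]

theorem adj_node_succ (hm : 2 ≤ m) (p : ℤ) :
    (SimpleGraph.cycleGraph m).Adj (node m p) (node m (p + 1)) := by
  rw [SimpleGraph.cycleGraph_adj', val_sub_eq_one_iff hm, val_sub_eq_one_iff hm]
  refine .inr ?_
  have := node_sub_node (m := m) p (p + 1)
  rwa [add_sub_cancel_left] at this

theorem eq_node_of_adj {p : ℤ} {v : Fin m} (h : (SimpleGraph.cycleGraph m).Adj (node m p) v) :
    v = node m (p + 1) ∨ v = node m (p - 1) := by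
  have hm : 2 ≤ m := by
    by_contra! hlt
    obtain rfl : m = 1 := by have := NeZero.pos m; omega
    exact SimpleGraph.cycleGraph_one_adj h
  rw [SimpleGraph.cycleGraph_adj', val_sub_eq_one_iff hm, val_sub_eq_one_iff hm] at h
  rw [← node_natCast v, node_eq_iff, node_eq_iff]
  have hv := node_sub_node (m := m) p (v : ℕ)
  rw [node_natCast] at hv
  obtain ⟨c, hc⟩ := hv
  rcases h with ⟨d, hd⟩ | ⟨d, hd⟩
  · exact .inr ⟨c + d, by linarith⟩
  · exact .inl ⟨c - d, by linarith⟩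

theorem isBundle_image_node {a b : ℤ} :
    IsBundle (SimpleGraph.cycleGraph m) ((Finset.Ico a b).image (node m)) := by
  set A : Finset (Fin m) := (Finset.Ico a b).image (node m) with hA
  have hmem : ∀ p, a ≤ p → p < b → node m p ∈ (A : Set (Fin m)) := fun p h1 h2 =>
    Finset.mem_coe.2 (Finset.mem_image_of_mem _ (Finset.mem_Ico.2 ⟨h1, h2⟩))
  have hreach : ∀ p (h1 : a ≤ p) (h2 : p < b),
      ((SimpleGraph.cycleGraph m).induce (A : Set (Fin m))).Reachable
        ⟨node m a, hmem a le_rfl (h1.trans_lt h2)⟩ ⟨node m p, hmem p h1 h2⟩ := by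
    intro p h1
    induction p, h1 using Int.leInduction with
    | base => exact fun _ => .rfl
    | succ p h1 ih =>
      intro h2
      refine (ih (by omega)).trans ?_
      rcases lt_or_ge 1 m with hm | hm
      · exact SimpleGraph.Adj.reachable (by simpa using adj_node_succ hm p)
      · have : (⟨node m p, hmem p h1 (by omega)⟩ : (A : Set (Fin m))) =
            ⟨node m (p + 1), hmem (p + 1) (by omega) h2⟩ := by
          refine Subtype.ext (Fin.ext ?_)
          have := (node m p).2
          have := (node m (p + 1)).2
          change (node m p : ℕ) = (node m (p + 1) : ℕ)
          omega
        rw [this]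
  rintro ⟨v, hv⟩ ⟨w, hw⟩
  obtain ⟨p, hp, rfl⟩ := Finset.mem_image.1 (Finset.mem_coe.1 hv)
  obtain ⟨q, hq, rfl⟩ := Finset.mem_image.1 (Finset.mem_coe.1 hw)
  rw [Finset.mem_Ico] at hp hq
  exact (hreach p hp.1 hp.2).symm.trans (hreach q hq.1 hq.2)

theorem bundleValue_image_node (w : Fin m → ℝ) {a b : ℤ} (h : b ≤ a + m) :
    bundleValue w ((Finset.Ico a b).image (node m)) = ∑ p ∈ Finset.Ico a b, w (node m p) := by
  refine Finset.sum_image fun p hp q hq hpq => ?_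
  rw [Finset.mem_coe, Finset.mem_Ico] at hp hq
  exact eq_of_node_eq hpq hp.1 (by omega) hq.1 (by omega)

/-- Prefix sums of a function on the integers. -/
theorem exists_primitive (f : ℤ → ℝ) :
    ∃ U : ℤ → ℝ, ∀ p q, p ≤ q → U q - U p = ∑ r ∈ Finset.Ico p q, f r := by
  have hcons : ∀ p q r : ℤ, p ≤ q → q ≤ r → ∑ i ∈ Finset.Ico p q, f i +
      ∑ i ∈ Finset.Ico q r, f i = ∑ i ∈ Finset.Ico p r, f i := fun p q r h1 h2 =>
    by rw [← Finset.sum_union (Finset.Ico_disjoint_Ico_consecutive p q r),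
      Finset.Ico_union_Ico_eq_Ico h1 h2]
  refine ⟨fun p => ∑ r ∈ Finset.Ico 0 p, f r - ∑ r ∈ Finset.Ico p 0, f r, fun p q h => ?_⟩
  rcases le_total 0 p with h1 | h1
  · have := hcons 0 p q h1 h
    simp only [Finset.Ico_eq_empty_of_le h1, Finset.Ico_eq_empty_of_le (h1.trans h),
      Finset.sum_empty]
    linarith
  · rcases le_total 0 q with h2 | h2
    · have := hcons p 0 q h1 h2
      simp only [Finset.Ico_eq_empty_of_le h1, Finset.Ico_eq_empty_of_le h2, Finset.sum_empty]
      linarith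
    · have := hcons p q 0 h h2
      simp only [Finset.Ico_eq_empty_of_le h1, Finset.Ico_eq_empty_of_le h2, Finset.sum_empty]
      linarith

end Unroll

/-! ### From splits to cuttings -/

section OfSplit

variable {m n : ℕ} [NeZero m]

/-- Every nonempty bundle is a stretch of the unrolled cycle. -/
theorem exists_stretch {A : Finset (Fin m)} (hA : IsBundle (SimpleGraph.cycleGraph m) A)
    (hne : A.Nonempty) :
    ∃ s e : ℤ, s < e ∧ e ≤ s + m ∧ (∀ p, s ≤ p → p < e → node m p ∈ A) ∧
      A = (Finset.Ico s e).image (node m) := by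
  have hm : (0 : ℤ) < m := by exact_mod_cast NeZero.pos m
  by_cases huniv : ∀ v, v ∈ A
  · refine ⟨0, m, hm, by simp, fun _ _ _ => huniv _, ?_⟩
    ext v
    obtain ⟨p, h1, h2, rfl⟩ := exists_node_eq 0 v
    exact iff_of_true (huniv _) (Finset.mem_image_of_mem _ (Finset.mem_Ico.2 ⟨h1, by omega⟩))
  obtain ⟨v, hv⟩ := hne
  push Not at huniv
  obtain ⟨w, hw⟩ := huniv
  obtain ⟨q, -, -, rfl⟩ := exists_node_eq 0 w
  obtain ⟨p, hp, hp', rfl⟩ := exists_node_eq q v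
  -- the last position before `p` that lies outside of `A`
  obtain ⟨s, ⟨hs, hsp⟩, hsmax⟩ := Int.exists_greatest_of_bdd
    (P := fun r => node m r ∉ A ∧ r ≤ p) ⟨p, fun r hr => hr.2⟩ ⟨q, hw, hp⟩
  have hsp' : s < p := lt_of_le_of_ne hsp (by rintro rfl; exact hs hv)
  -- the first position after `p` that lies outside of `A`
  obtain ⟨e, ⟨he, hpe⟩, hemin⟩ := Int.exists_least_of_bdd
    (P := fun r => node m r ∉ A ∧ p ≤ r) ⟨p, fun r hr => hr.2⟩
    ⟨q + m, by have := node_add_mul (m := m) q 1; rw [one_mul] at this; rwa [this], by omega⟩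
  have hpe' : p < e := lt_of_le_of_ne hpe (by rintro rfl; exact he hv)
  have hmem : ∀ r, s + 1 ≤ r → r < e → node m r ∈ A := by
    intro r h1 h2
    by_contra hr
    rcases le_total r p with h | h
    · have := hsmax r ⟨hr, h⟩
      omega
    · have := hemin r ⟨hr, h⟩
      omega
  have hes : e ≤ s + m := by
    refine hemin _ ⟨by have := node_add_mul (m := m) s 1; rw [one_mul] at this; rwa [this], ?_⟩
    by_contra! hlt
    have := hmem (s + m) (by omega) (by omega)
    have h1 := node_add_mul (m := m) s 1
    rw [one_mul] at h1
    exact hs (h1 ▸ this)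
  refine ⟨s + 1, e, by omega, by omega, hmem, ?_⟩
  -- neighbours within `A` of nodes of the stretch belong to the stretch
  have hwalk : ∀ a b : (A : Set (Fin m)),
      ((SimpleGraph.cycleGraph m).induce (A : Set (Fin m))).Walk a b →
      (a : Fin m) ∈ (Finset.Ico (s + 1) e).image (node m) →
      (b : Fin m) ∈ (Finset.Ico (s + 1) e).image (node m) := by
    intro a b W
    induction W with
    | nil => exact id
    | @cons a b _ hab _ ih =>
      intro ha
      refine ih ?_
      obtain ⟨r, hr, hra⟩ := Finset.mem_image.1 ha
      rw [Finset.mem_Ico] at hr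
      have hadj : (SimpleGraph.cycleGraph m).Adj (node m r) b := by
        rw [hra]
        exact hab
      have hb : (b : Fin m) ∈ A := b.2
      rcases eq_node_of_adj hadj with h | h
      · rw [h] at hb ⊢
        refine Finset.mem_image_of_mem _ (Finset.mem_Ico.2 ⟨by omega, ?_⟩)
        by_contra! hle
        exact he (by rwa [show e = r + 1 by omega])
      · rw [h] at hb ⊢
        refine Finset.mem_image_of_mem _ (Finset.mem_Ico.2 ⟨?_, by omega⟩)
        by_contra! hlt
        exact hs (by rwa [show s = r - 1 by omega])
  refine Finset.Subset.antisymm (fun w hw => ?_) (fun w hw => ?_)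
  · obtain ⟨W⟩ := hA ⟨node m p, hv⟩ ⟨w, hw⟩
    exact hwalk _ _ W (Finset.mem_image_of_mem _ (Finset.mem_Ico.2 ⟨by omega, hpe'⟩))
  · obtain ⟨r, hr, rfl⟩ := Finset.mem_image.1 hw
    rw [Finset.mem_Ico] at hr
    exact hmem r hr.1 hr.2

/-- Finitely many residues modulo `m` are enumerated in increasing order by the integers. -/
theorem exists_enumeration {m : ℕ} (hn : 1 ≤ n) {s : Fin n → ℤ} (hs : Function.Injective s)
    (h0 : ∀ i, 0 ≤ s i) (hm : ∀ i, s i < m) :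
    ∃ cut : ℤ → ℤ, (∀ k, cut (k + n) = cut k + m) ∧ (∀ k, cut k < cut (k + 1)) ∧
      ∀ k, ∃ i t, cut k = s i + t * m := by
  have hn0 : (0 : ℤ) < n := by exact_mod_cast hn
  have hidx : ∀ k : ℤ, (k % n).toNat < n := fun k => by
    have := Int.emod_lt_of_pos k hn0
    have := Int.emod_nonneg k hn0.ne'
    omega
  have hmono : StrictMono (s ∘ Tuple.sort s) :=
    (Tuple.monotone_sort s).strictMono_of_injective (hs.comp (Tuple.sort s).injective)
  set a : Fin n → ℤ := s ∘ Tuple.sort s with ha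
  refine ⟨fun k => a ⟨_, hidx k⟩ + k / n * m, fun k => ?_, fun k => ?_, fun k => ⟨_, _, rfl⟩⟩
  · have h1 : (k + n) / n = k / n + 1 := by
      rw [Int.add_ediv_of_dvd_right dvd_rfl, Int.ediv_self hn0.ne']
    simp only [Int.add_emod_right, h1]
    ring
  · have hk := Int.emod_add_mul_ediv k n
    have h1 := Int.emod_lt_of_pos k hn0
    have h2 := Int.emod_nonneg k hn0.ne'
    rcases eq_or_ne (k % n + 1) n with h | h
    · have hk1 : k + 1 = 0 + n * (k / n + 1) := by linarith
      have h3 : (k + 1) / n = k / n + 1 := by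
        rw [hk1, Int.add_mul_ediv_left _ _ hn0.ne']
        simp
      have h4 := h0 (Tuple.sort s ⟨_, hidx (k + 1)⟩)
      have h5 := hm (Tuple.sort s ⟨_, hidx k⟩)
      simp only [h3, ha, Function.comp_apply]
      linarith
    · have h3 : (k + 1) / n = k / n := by
        rw [show k + 1 = (k % n + 1) + n * (k / n) by linarith,
          Int.add_mul_ediv_left _ _ hn0.ne', Int.ediv_eq_zero_of_lt (by omega) (by omega), zero_add]
      have h4 : (k + 1) % n = k % n + 1 := by
        have := Int.emod_add_mul_ediv (k + 1) n
        rw [h3] at this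
        linarith
      simp only [h3]
      have : a ⟨_, hidx k⟩ < a ⟨_, hidx (k + 1)⟩ := hmono (by
        simp only [Fin.mk_lt_mk, h4]
        omega)
      linarith

/-- A split whose bundles are all worth at least `1` gives rise to a cutting. -/
theorem exists_cutting (hn : 1 ≤ n) {w : Fin m → ℝ} (hw : ∀ v, 0 ≤ w v)
    {P : Fin n → Finset (Fin m)} (hP : IsSplit (SimpleGraph.cycleGraph m) P)
    (h1 : ∀ i, 1 ≤ bundleValue w (P i)) :
    ∃ S : Cutting m n, ∀ p q, p ≤ q → S.U q - S.U p = ∑ r ∈ Finset.Ico p q, w (node m r) := by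
  have hm : (0 : ℤ) < m := by exact_mod_cast NeZero.pos m
  obtain ⟨U, hU⟩ := exists_primitive fun r => w (node m r)
  have hmono : Monotone U := fun p q h => by
    have := Finset.sum_nonneg fun r (_ : r ∈ Finset.Ico p q) => hw (node m r)
    linarith [hU p q h]
  have hper : ∀ p q, p ≤ q → U (q + m) - U (p + m) = U q - U p := by
    intro p q h
    rw [hU p q h, hU _ _ (by omega), ← Finset.image_add_right_Ico,
      Finset.sum_image (add_left_injective _).injOn]
    refine Finset.sum_congr rfl fun r _ => ?_
    have := node_add_mul (m := m) r 1
    rw [one_mul] at this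
    rw [this]
  have hperiod : ∀ p q, U (q + m) - U (p + m) = U q - U p := by
    intro p q
    rcases le_total p q with h | h
    · exact hper p q h
    · linarith [hper q p h]
  have hne : ∀ i, (P i).Nonempty := by
    intro i
    by_contra h
    have := h1 i
    rw [Finset.not_nonempty_iff_eq_empty.1 h] at this
    simp [bundleValue] at this
    linarith
  choose s e hse hem hmem himg using fun i => exists_stretch (hP.bundle i) (hne i)
  have huniq : ∀ {i j v}, v ∈ P i → v ∈ P j → i = j := fun {i j v} hi hj => by
    by_contra h
    exact Finset.disjoint_left.1 (hP.disjoint i j h) hi hj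
  have hinj : Function.Injective fun i => s i % (m : ℤ) := fun i j h => by
    refine huniq (hmem i (s i) le_rfl (hse i)) ?_
    have : node m (s i) = node m (s j) := node_eq_iff.2 (Int.modEq_iff_dvd.1 h)
    rw [this]
    exact hmem j (s j) le_rfl (hse j)
  obtain ⟨cut, hcper, hclt, hcs⟩ := exists_enumeration (m := m) hn hinj
    (fun i => Int.emod_nonneg _ hm.ne') (fun i => Int.emod_lt_of_pos _ hm)
  have hcs' : ∀ k, ∃ i t, cut k = s i + t * m := by
    intro k
    obtain ⟨i, t, h⟩ := hcs k
    exact ⟨i, t - s i / m, by linarith [Int.emod_add_mul_ediv (s i) m]⟩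
  refine ⟨⟨U, hmono, hperiod, cut, hcper, fun k => ?_⟩, hU⟩
  obtain ⟨i, t, hk⟩ := hcs' k
  obtain ⟨j, t', hk'⟩ := hcs' (k + 1)
  -- the next bundle cannot begin within the stretch of the bundle `i`
  have hle : e i + t * m ≤ cut (k + 1) := by
    by_contra! hlt
    have hlt0 := hclt k
    have h2 := hmem i (cut (k + 1) - t * m) (by omega) (by omega)
    have h3 : node m (cut (k + 1) - t * m) = node m (s j) := by
      rw [hk', ← node_add_mul (s j) (t' - t)]
      congr 1
      ring
    rw [h3] at h2
    obtain rfl := huniq h2 (hmem j (s j) le_rfl (hse j))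
    have h4 : t < t' := by
      by_contra! h
      nlinarith
    have h5 := hem i
    nlinarith
  have hval : 1 ≤ U (e i) - U (s i) := by
    rw [hU _ _ (hse i).le, ← bundleValue_image_node w (hem i), ← himg i]
    exact h1 i
  have hshift : ∀ t : ℕ, ∀ p q, U (q + t * m) - U (p + t * m) = U q - U p := by
    intro t
    induction t with
    | zero => simp
    | succ t ih =>
      intro p q
      have h2 := hperiod (p + t * m) (q + t * m)
      rw [ih] at h2
      push_cast
      rw [show p + (t + 1) * (m : ℤ) = p + t * m + m by ring,
        show q + (t + 1) * (m : ℤ) = q + t * m + m by ring, h2]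
  have hval' : U (e i + t * m) - U (s i + t * m) = U (e i) - U (s i) := by
    rcases Int.eq_nat_or_neg t with ⟨r, rfl | rfl⟩
    · exact hshift r _ _
    · have := hshift r (s i + -r * m) (e i + -r * m)
      rw [← this]
      congr 2 <;> ring
  rw [hk]
  linarith [hmono hle]

end OfSplit

/-! ### From served agents to allocations -/

section Allocation

variable {m n : ℕ}

/-- Served agents `I` get disjoint stretches, which can be taken to cover everything. -/
theorem Serv.exists_stretches {ι : Type*} [DecidableEq ι] {S : ι → Cutting m n} {p q : ℤ}
    {M : Multiset (Cutting m n)} (h : Serv p q M) (I : Finset ι) (hI : I.val.map S = M)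
    (hne : I.Nonempty) :
    ∃ L R : ι → ℤ, (∀ i ∈ I, p ≤ L i ∧ L i ≤ R i ∧ R i ≤ q ∧
        3 / 4 ≤ (S i).U (R i) - (S i).U (L i)) ∧
      (∀ i ∈ I, ∀ j ∈ I, i ≠ j → R i ≤ L j ∨ R j ≤ L i) ∧
      ∀ r, p ≤ r → r < q → ∃ i ∈ I, L i ≤ r ∧ r < R i := by
  induction h generalizing I with
  | nil _ =>
    rw [Multiset.map_eq_zero, Finset.val_eq_zero] at hI
    exact absurd hI hne.ne_empty
  | @cons p p' q T M hp hT hM ih =>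
    obtain ⟨i, hi, hiT⟩ : ∃ i ∈ I, S i = T := by
      have : T ∈ I.val.map S := by rw [hI]; exact Multiset.mem_cons_self _ _
      simpa using this
    subst hiT
    have hI' : (I.erase i).val.map S = M := by
      rw [← Finset.insert_erase hi, Finset.insert_val,
        Multiset.ndinsert_of_notMem (Finset.notMem_erase i I), Multiset.map_cons] at hI
      exact (Multiset.cons_inj_right _).1 hI
    rcases (I.erase i).eq_empty_or_nonempty with he | he
    · have hall : ∀ j ∈ I, j = i := fun j hj => by
        by_contra hji
        have : j ∈ I.erase i := Finset.mem_erase.2 ⟨hji, hj⟩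
        simp [he] at this
      refine ⟨fun _ => p, fun _ => q, fun j hj => ?_, fun j hj l hl hjl => ?_,
        fun r h1 h2 => ⟨i, hi, h1, h2⟩⟩
      · obtain rfl := hall j hj
        exact ⟨le_rfl, hp.trans hM.le, le_rfl, by linarith [(S j).mono hM.le]⟩
      · exact absurd ((hall j hj).trans (hall l hl).symm) hjl
    · obtain ⟨L, R, h1, h2, h3⟩ := ih (I.erase i) hI' he
      refine ⟨Function.update L i p, Function.update R i p', fun j hj => ?_,
        fun j hj l hl hjl => ?_, fun r hr hr' => ?_⟩
      · by_cases hji : j = i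
        · subst hji
          simpa using ⟨hp, hM.le, hT⟩
        · obtain ⟨h4, h5⟩ := h1 j (Finset.mem_erase.2 ⟨hji, hj⟩)
          simp only [Function.update_of_ne hji]
          exact ⟨hp.trans h4, h5⟩
      · by_cases hji : j = i
        · subst hji
          have hlj := hjl.symm
          simp only [Function.update_self, Function.update_of_ne hlj]
          exact .inl (h1 l (Finset.mem_erase.2 ⟨hlj, hl⟩)).1
        · by_cases hli : l = i
          · subst hli
            simp only [Function.update_self, Function.update_of_ne hji]
            exact .inr (h1 j (Finset.mem_erase.2 ⟨hji, hj⟩)).1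
          · simp only [Function.update_of_ne hli, Function.update_of_ne hji]
            exact h2 j (Finset.mem_erase.2 ⟨hji, hj⟩) l (Finset.mem_erase.2 ⟨hli, hl⟩) hjl
      · rcases lt_or_ge r p' with hlt | hge
        · exact ⟨i, hi, by simpa using hr, by simpa using hlt⟩
        · obtain ⟨j, hj, h4⟩ := h3 r hge hr'
          rw [Finset.mem_erase] at hj
          refine ⟨j, hj.2, ?_⟩
          simpa only [Function.update_of_ne hj.1] using h4

theorem Solvable.exists_isSplit [NeZero m] {S : Fin n → Cutting m n} (hn : 1 ≤ n)
    (h : Solvable (Finset.univ.val.map S)) :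
    ∃ P : Fin n → Finset (Fin m), IsSplit (SimpleGraph.cycleGraph m) P ∧
      ∀ i, ∀ w : Fin m → ℝ,
        (∀ p q, p ≤ q → (S i).U q - (S i).U p = ∑ r ∈ Finset.Ico p q, w (node m r)) →
        3 / 4 ≤ bundleValue w (P i) := by
  obtain ⟨p, hp⟩ := h
  obtain ⟨L, R, h1, h2, h3⟩ := hp.exists_stretches Finset.univ rfl ⟨⟨0, hn⟩, Finset.mem_univ _⟩
  simp only [Finset.mem_univ, true_and, forall_const] at h1 h2 h3
  refine ⟨fun i => (Finset.Ico (L i) (R i)).image (node m), ⟨fun i => isBundle_image_node,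
    fun i j hij => ?_, fun v => ?_⟩, fun i w hw => ?_⟩
  · rw [Finset.disjoint_left]
    intro v hi hj
    obtain ⟨r, hr, rfl⟩ := Finset.mem_image.1 hi
    obtain ⟨r', hr', heq⟩ := Finset.mem_image.1 hj
    rw [Finset.mem_Ico] at hr hr'
    have hi' := h1 i
    have hj' := h1 j
    have := eq_of_node_eq (a := p) heq (by omega) (by omega) (by omega) (by omega)
    have := h2 i j hij
    omega
  · obtain ⟨r, h4, h5, rfl⟩ := exists_node_eq p v
    obtain ⟨i, h6, h7⟩ := h3 r h4 h5
    exact ⟨i, Finset.mem_image_of_mem _ (Finset.mem_Ico.2 ⟨h6, h7⟩)⟩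
  · obtain ⟨h4, h5, h6, h7⟩ := h1 i
    rw [bundleValue_image_node w (by omega), ← hw _ _ h5]
    exact h7

theorem exists_eq_agents {x y z : Cutting m n} (M : Multiset (Cutting m n))
    (h : ∀ S ∈ M, S = x ∨ S = y ∨ S = z) : ∃ a b c, M = Slots.agents x y z a b c := by
  induction M using Multiset.induction with
  | empty => exact ⟨0, 0, 0, by simp [Slots.agents]⟩
  | cons S M ih =>
    obtain ⟨a, b, c, rfl⟩ := ih fun T hT => h T (Multiset.mem_cons_of_mem hT)
    rcases h S (Multiset.mem_cons_self _ _) with rfl | rfl | rfl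
    · exact ⟨a + 1, b, c, (Slots.agents_succ_left ..).symm⟩
    · exact ⟨a, b + 1, c, (agents_succ_mid ..).symm⟩
    · exact ⟨a, b, c + 1, (Slots.agents_succ_right ..).symm⟩

theorem exists_three_of_ncard_le {α : Type*} {s : Set α} (hs : s.Finite) (hne : s.Nonempty)
    (h : s.ncard ≤ 3) : ∃ x y z, ∀ a ∈ s, a = x ∨ a = y ∨ a = z := by
  have hpos := (Set.ncard_pos hs).2 hne
  obtain h | h | h : s.ncard = 1 ∨ s.ncard = 2 ∨ s.ncard = 3 := by omega
  · obtain ⟨x, rfl⟩ := Set.ncard_eq_one.1 h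
    exact ⟨x, x, x, by simp⟩
  · obtain ⟨x, y, -, rfl⟩ := Set.ncard_eq_two.1 h
    exact ⟨x, y, y, by simp⟩
  · obtain ⟨x, y, z, -, -, -, rfl⟩ := Set.ncard_eq_three.1 h
    exact ⟨x, y, z, by simp⟩

/-- Agents whose maximin share is positive have a cutting, in which their utility is measured in
units of their maximin share. -/
theorem exists_cutting_of_maximinShare_pos [NeZero m] (hn : 1 ≤ n) {w : Fin m → ℝ}
    (hw : ∀ v, 0 ≤ w v) (hpos : 0 < maximinShare (SimpleGraph.cycleGraph m) n w) :
    ∃ S : Cutting m n, ∀ p q, p ≤ q → S.U q - S.U p =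
      ∑ r ∈ Finset.Ico p q, w (node m r) / maximinShare (SimpleGraph.cycleGraph m) n w := by
  obtain ⟨-, P, hP, h⟩ := (isGreatest_maximinShare SimpleGraph.cycleGraph_preconnected hn hw).1
  refine exists_cutting (w := fun v => w v / maximinShare (SimpleGraph.cycleGraph m) n w) hn
    (fun v => div_nonneg (hw v) hpos.le) hP fun i => ?_
  rw [bundleValue, ← Finset.sum_div, one_le_div hpos]
  exact h i

theorem exists_isSufficientAllocation {u : Fin n → Fin m → ℝ} (hn : 1 ≤ n)
    (hu : ∀ i v, 0 ≤ u i v) (h3 : numTypes u ≤ 3) :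
    ∃ P : Fin n → Finset (Fin m),
      IsSufficientAllocation (SimpleGraph.cycleGraph m) u (3 / 4) P := by
  have hgr := fun i => isGreatest_maximinShare SimpleGraph.cycleGraph_preconnected hn (hu i)
  by_cases h0 : ∀ i, maximinShare (SimpleGraph.cycleGraph m) n (u i) ≤ 0
  · obtain ⟨-, P, hP, -⟩ := (hgr ⟨0, hn⟩).1
    refine ⟨P, hP, fun i => ?_⟩
    have : 0 ≤ bundleValue (u i) (P i) := Finset.sum_nonneg fun v _ => hu i v
    linarith [h0 i]
  push Not at h0
  obtain ⟨i₀, hi₀⟩ := h0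
  have : NeZero m := ⟨by
    rintro rfl
    obtain ⟨-, P, -, hP⟩ := (hgr i₀).1
    have := hP i₀
    rw [Finset.eq_empty_of_isEmpty (P i₀)] at this
    simp [bundleValue] at this
    linarith⟩
  obtain ⟨S₀, -⟩ := exists_cutting_of_maximinShare_pos hn (hu i₀) hi₀
  -- agents whose maximin share is `0` are happy with any bundle and may use the cutting `S₀`
  have hex : ∀ w : Fin m → ℝ, ∃ S : Cutting m n, (∀ v, 0 ≤ w v) →
      0 < maximinShare (SimpleGraph.cycleGraph m) n w → ∀ p q, p ≤ q → S.U q - S.U p =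
        ∑ r ∈ Finset.Ico p q, w (node m r) / maximinShare (SimpleGraph.cycleGraph m) n w := by
    intro w
    by_cases h : (∀ v, 0 ≤ w v) ∧ 0 < maximinShare (SimpleGraph.cycleGraph m) n w
    · obtain ⟨S, hS⟩ := exists_cutting_of_maximinShare_pos hn h.1 h.2
      exact ⟨S, fun _ _ => hS⟩
    · exact ⟨S₀, fun h1 h2 => absurd ⟨h1, h2⟩ h⟩
  choose T hT using hex
  obtain ⟨x, y, z, hxyz⟩ := exists_three_of_ncard_le (Set.finite_range u)
    ⟨_, Set.mem_range_self i₀⟩ h3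
  have hsolv : Solvable (Finset.univ.val.map fun i => T (u i)) := by
    obtain ⟨a, b, c, habc⟩ := exists_eq_agents (x := T x) (y := T y) (z := T z)
      (Finset.univ.val.map fun i => T (u i)) (by
        intro S hS
        obtain ⟨i, -, rfl⟩ := Multiset.mem_map.1 hS
        rcases hxyz _ (Set.mem_range_self i) with h | h | h <;> simp [h])
    have hcard := congrArg Multiset.card habc
    rw [Slots.card_agents, Multiset.card_map, Finset.card_val, Finset.card_univ,
      Fintype.card_fin] at hcard
    rw [habc]
    exact solvable_three hn hcard.symm
  obtain ⟨P, hP, hval⟩ := hsolv.exists_isSplit hn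
  refine ⟨P, hP, fun i => ?_⟩
  rcases le_or_gt (maximinShare (SimpleGraph.cycleGraph m) n (u i)) 0 with h | h
  · have : 0 ≤ bundleValue (u i) (P i) := Finset.sum_nonneg fun v _ => hu i v
    linarith
  · have := hval i (fun v => u i v / maximinShare (SimpleGraph.cycleGraph m) n (u i))
      (hT (u i) (hu i) h)
    rw [bundleValue, ← Finset.sum_div, le_div_iff₀ h] at this
    exact this

end Allocation

/-! ### An example in which `3 / 4` is optimal -/

section Example

/-- The utilities of three types of agents on a cycle of `18` goods; they are repeated after
every `6` goods. -/
def exampleUtility (t : Fin 3) (v : Fin 18) : ℕ :=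
  (![![3, 1, 2, 2, 1, 3], ![1, 2, 2, 1, 3, 3], ![2, 2, 2, 2, 2, 2]] : Fin 3 → Fin 6 → ℕ) t
    ⟨v.val % 6, Nat.mod_lt _ (by norm_num)⟩

/-- The types of the nine agents of the example. -/
def exampleType : Fin 9 → Fin 3 := ![0, 0, 0, 0, 1, 1, 1, 1, 2]

/-- The split of the `18` goods into the pairs that begin at the positions of the parity of `a`. -/
def pairSplit (a : Fin 18) (i : Fin 9) : Finset (Fin 18) :=
  {a + 2 * i.castLE (by norm_num), a + 2 * i.castLE (by norm_num) + 1}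

theorem adj_add_one (v : Fin 18) : (SimpleGraph.cycleGraph 18).Adj v (v + 1) :=
  SimpleGraph.cycleGraph_adj.2 (.inr (add_sub_cancel_left v 1))

theorem isSplit_pairSplit {a : Fin 18} (ha : a = 0 ∨ a = 1) :
    IsSplit (SimpleGraph.cycleGraph 18) (pairSplit a) where
  bundle i := by
    rw [IsBundle, pairSplit, Finset.coe_pair]
    exact (SimpleGraph.induce_pair_connected_of_adj (adj_add_one _)).preconnected
  disjoint := by rcases ha with rfl | rfl <;> decide
  cover := by rcases ha with rfl | rfl <;> decide

theorem bundleValue_natCast {V : Type*} (f : V → ℕ) (P : Finset V) :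
    bundleValue (fun v => (f v : ℝ)) P = (∑ v ∈ P, f v : ℕ) := by
  simp [bundleValue]

theorem four_le_maximinShare (t : Fin 3) :
    4 ≤ maximinShare (SimpleGraph.cycleGraph 18) 9 fun v => (exampleUtility t v : ℝ) := by
  refine (isGreatest_maximinShare SimpleGraph.cycleGraph_preconnected (by norm_num)
    fun v => Nat.cast_nonneg _).2 ⟨by norm_num, ?_⟩
  have h : ∀ t, ∃ a : Fin 18, (a = 0 ∨ a = 1) ∧
      ∀ i, 4 ≤ ∑ v ∈ pairSplit a i, exampleUtility t v := by decide
  obtain ⟨a, ha, hval⟩ := h t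
  refine ⟨pairSplit a, isSplit_pairSplit ha, fun i => ?_⟩
  rw [bundleValue_natCast]
  exact_mod_cast hval i

/-- A connected pair of goods consists of two consecutive goods. -/
theorem exists_eq_pair {P : Finset (Fin 18)} (hP : IsBundle (SimpleGraph.cycleGraph 18) P)
    (hcard : P.card = 2) : ∃ v, P = {v, v + 1} := by
  obtain ⟨a, b, hab, rfl⟩ := Finset.card_eq_two.1 hcard
  have hadj : (SimpleGraph.cycleGraph 18).Adj a b := by
    obtain ⟨W⟩ := hP ⟨a, by simp⟩ ⟨b, by simp⟩
    cases W with
    | nil => exact absurd rfl hab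
    | @cons _ c _ h _ =>
      obtain ⟨c, hc⟩ := c
      have h' : (SimpleGraph.cycleGraph 18).Adj a c := h
      have hc' : c = a ∨ c = b := by simpa using hc
      rcases hc' with rfl | rfl
      · exact absurd h' (SimpleGraph.irrefl _)
      · exact h'
  rcases SimpleGraph.cycleGraph_adj.1 hadj with h | h
  · exact ⟨b, by rw [← h, add_sub_cancel, Finset.pair_comm]⟩
  · exact ⟨a, by rw [← h, add_sub_cancel]⟩

theorem not_exists_isSplit {P : Fin 9 → Finset (Fin 18)}
    (hP : IsSplit (SimpleGraph.cycleGraph 18) P)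
    (hval : ∀ i, 4 ≤ ∑ v ∈ P i, exampleUtility (exampleType i) v) : False := by
  -- no good is worth more than `3`, so every bundle contains at least, hence exactly, two goods
  have htwo : ∀ i, 2 ≤ (P i).card := by
    intro i
    have h3 : ∀ t v, exampleUtility t v ≤ 3 := by decide
    have h4 := (hval i).trans
      (Finset.sum_le_card_nsmul (P i) _ 3 fun v _ => h3 (exampleType i) v)
    rw [smul_eq_mul] at h4
    omega
  have hsum : ∑ i, (P i).card = 18 := by
    rw [← Finset.card_biUnion fun i _ j _ hij => hP.disjoint i j hij]
    have : Finset.univ.biUnion P = Finset.univ := by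
      ext v
      simpa using hP.cover v
    rw [this]
    rfl
  have hcard : ∀ i, (P i).card = 2 := by
    intro i
    have h := (Finset.sum_eq_sum_iff_of_le (s := Finset.univ) (f := fun _ : Fin 9 => 2)
      fun i _ => htwo i).1 (by rw [hsum]; rfl) i (Finset.mem_univ _)
    exact h.symm
  choose s hs using fun i => exists_eq_pair (hP.bundle i) (hcard i)
  have huniq : ∀ {i j v}, v ∈ P i → v ∈ P j → i = j := fun {i j v} hi hj => by
    by_contra h
    exact Finset.disjoint_left.1 (hP.disjoint i j h) hi hj
  have hs0 : ∀ i, s i ∈ P i := fun i => by rw [hs i]; simp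
  have hs1 : ∀ i, s i + 1 ∈ P i := fun i => by rw [hs i]; simp
  have hinj : Function.Injective s := fun i j h => huniq (hs0 i) (h ▸ hs0 j)
  -- a pair is followed by a pair
  have hnext : ∀ i, ∃ j, s j = s i + 2 := by
    intro i
    obtain ⟨j, hj⟩ := hP.cover (s i + 2)
    have hj' := hj
    rw [hs j, Finset.mem_insert, Finset.mem_singleton] at hj'
    rcases hj' with h | h
    · exact ⟨j, h.symm⟩
    · have h1 : s j = s i + 1 := by
        have : ∀ a b : Fin 18, a + 2 = b + 1 → b = a + 1 := by decide
        exact this _ _ h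
      obtain rfl := huniq (hs1 i) (h1 ▸ hs0 j)
      have : ∀ a : Fin 18, a ≠ a + 1 := by decide
      exact absurd h1 (this _)
  have hall : ∀ (i : Fin 9) (k : ℕ), ∃ j, s j = s i + Fin.ofNat 18 (2 * k) := by
    intro i k
    induction k with
    | zero => exact ⟨i, by simp⟩
    | succ k ih =>
      obtain ⟨j, hj⟩ := ih
      obtain ⟨l, hl⟩ := hnext j
      refine ⟨l, ?_⟩
      rw [hl, hj, add_assoc]
      congr 1
      ext
      simp [Fin.val_add]
      omega
  have hpar : ∀ i j, (s i).val % 2 = (s j).val % 2 := by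
    intro i j
    by_contra hne
    have hd : ∀ a b : Fin 18, a.val % 2 ≠ b.val % 2 →
        ∃ k : Fin 9, b = a + Fin.ofNat 18 (2 * k) + 1 := by decide
    obtain ⟨k, hk⟩ := hd _ _ hne
    obtain ⟨l, hl⟩ := hall i k
    rw [← hl] at hk
    obtain rfl := huniq (hs1 l) (hk ▸ hs0 j)
    have : ∀ a : Fin 18, a ≠ a + 1 := by decide
    exact this _ hk
  have hval' : ∀ i, 4 ≤ exampleUtility (exampleType i) (s i) +
      exampleUtility (exampleType i) (s i + 1) := by
    intro i
    have h := hval i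
    have : ∀ a : Fin 18, a ≠ a + 1 := by decide
    rwa [hs i, Finset.sum_pair (this _)] at h
  -- four agents of one type compete for the only three pairs that are worth more than `3` to them
  have hpigeon : ∀ (I : Finset (Fin 9)) (J : Finset (Fin 18)), J.card < I.card →
      ¬ ∀ i ∈ I, s i ∈ J := fun I J h hIJ =>
    absurd (Finset.card_le_card_of_injOn s hIJ hinj.injOn) (by omega)
  rcases Nat.mod_two_eq_zero_or_one (s 0).val with h0 | h0
  · refine hpigeon {4, 5, 6, 7} {4, 10, 16} (by decide) fun i hi => ?_
    have ht : ∀ i ∈ ({4, 5, 6, 7} : Finset (Fin 9)), exampleType i = 1 := by decide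
    have hd : ∀ a : Fin 18, a.val % 2 = 0 → 4 ≤ exampleUtility 1 a + exampleUtility 1 (a + 1) →
        a ∈ ({4, 10, 16} : Finset (Fin 18)) := by decide
    exact hd _ ((hpar i 0).trans h0) (ht i hi ▸ hval' i)
  · refine hpigeon {0, 1, 2, 3} {5, 11, 17} (by decide) fun i hi => ?_
    have ht : ∀ i ∈ ({0, 1, 2, 3} : Finset (Fin 9)), exampleType i = 0 := by decide
    have hd : ∀ a : Fin 18, a.val % 2 = 1 → 4 ≤ exampleUtility 0 a + exampleUtility 0 (a + 1) →
        a ∈ ({5, 11, 17} : Finset (Fin 18)) := by decide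
    exact hd _ ((hpar i 0).trans h0) (ht i hi ▸ hval' i)

theorem numTypes_example :
    numTypes (fun i v => (exampleUtility (exampleType i) v : ℝ)) = 3 := by
  have hinj : Function.Injective fun t v => (exampleUtility t v : ℝ) := by
    intro t t' h
    have hd : ∀ t t', (∀ v, exampleUtility t v = exampleUtility t' v) → t = t' := by decide
    exact hd t t' fun v => Nat.cast_injective (R := ℝ) (congrFun h v)
  have hsurj : Function.Surjective exampleType := by decide
  have hr := hsurj.range_comp fun t v => (exampleUtility t v : ℝ)
  unfold numTypes
  change (Set.range ((fun t v => (exampleUtility t v : ℝ)) ∘ exampleType)).ncard = 3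
  rw [hr, ← Set.image_univ, Set.ncard_image_of_injective _ hinj, Set.ncard_univ, Nat.card_fin]

theorem not_isSufficientAllocation_example {c : ℝ} (hc : 3 / 4 < c) (P : Fin 9 → Finset (Fin 18)) :
    ¬ IsSufficientAllocation (SimpleGraph.cycleGraph 18)
      (fun i v => (exampleUtility (exampleType i) v : ℝ)) c P := by
  rintro ⟨hP, hval⟩
  refine not_exists_isSplit hP fun i => ?_
  have h := hval i
  rw [bundleValue_natCast] at h
  have h4 := four_le_maximinShare (exampleType i)
  have : (3 : ℝ) < (∑ v ∈ P i, exampleUtility (exampleType i) v : ℕ) := by nlinarith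
  exact_mod_cast this

end Example

theorem mainTheorem2 :
    (∀ (m n : ℕ) (u : Fin n → Fin m → ℝ), 1 ≤ n → (∀ i v, 0 ≤ u i v) → numTypes u ≤ 3 →
      ∃ P : Fin n → Finset (Fin m),
        IsSufficientAllocation (SimpleGraph.cycleGraph m) u (3 / 4) P) ∧
    (∃ (m n : ℕ) (u : Fin n → Fin m → ℝ), 3 ≤ m ∧ 1 ≤ n ∧ (∀ i v, 0 ≤ u i v) ∧
      numTypes u = 3 ∧
      ∀ c : ℝ, 3 / 4 < c → ¬ ∃ P : Fin n → Finset (Fin m),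
        IsSufficientAllocation (SimpleGraph.cycleGraph m) u c P) :=
  ⟨fun _ _ _ hn hu h3 => exists_isSufficientAllocation hn hu h3,
    18, 9, fun i v => (exampleUtility (exampleType i) v : ℝ), by norm_num, by norm_num,
    fun _ _ => Nat.cast_nonneg _, numTypes_example,
    fun _ hc ⟨P, hP⟩ => not_isSufficientAllocation_example hc P hP⟩
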